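/- Conventions. A monoidal triangulated category (M$\Delta$C) is a triangulated category with a monoidal structure $(\otimes, 1)$ such that $\otimes$ is exact in each variable. It is compactly generated if: it has set-indexed coproducts and $\otimes$ preserves them in each variable; the isomorphism classes of its compact objects form a set, and for every $M \neq 0$ there are a compact object $C$ and a non-zero morphism $C \to M$; and $1$ is compact, tensor products of compact objects are compact, and every compact object is rigid (has a left and a right dual). Write $\mathbf K^c$ for the full subcategory of compact objects of $\mathbf K$. A thick ideal is a full triangulated subcategory closed under direct summands and under left and right tensoring with arbitrary objects. For an object $M$ of $\mathbf K$, $\langle\!\langle M\rangle\!\rangle$ is the smallest thick ideal of $\mathbf K$ containing $M$; for a collection $\mathcal S$ of objects of $\mathbf K^c$, $\langle \mathcal S\rangle$ is the smallest thick ideal of $\mathbf K^c$ containing $\mathcal S$. Let $\mathbf I\otimes\mathbf J$ be the collection of objects isomorphic to some $A\otimes B$ with $A\in\mathbf I$, $B\in\mathbf J$. A prime ideal of $\mathbf K^c$ is a proper thick ideal $\mathbf P$ such that $\mathbf I\otimes\mathbf J\subseteq\mathbf P$ implies $\mathbf I\subseteq\mathbf P$ or $\mathbf J\subseteq\mathbf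 P$ for all thick ideals $\mathbf I,\mathbf J$ of $\mathbf K^c$. $\operatorname{Spc}\mathbf K^c$ is the set of prime ideals of $\mathbf K^c$, with the topology generated by the closed sets $V(\mathcal S)=\{\mathbf P : \mathbf P\cap\mathcal S=\varnothing\}$ for all collections $\mathcal S$ of objects of $\mathbf K^c$; write $V(A)=V(\{A\})$. A Zariski space is a Noetherian topological space in which every irreducible closed subset has a unique generic point. A specialization-closed subset of $X$ is a union of closed subsets; $\mathcal X_{sp}$ is the set of these, and $S_{sp}$ is the union of all closed sets contained in $S\subseteq X$. An extended weak support datum on $\mathbf K$ with values in $X$ is a map $\sigma$ from objects of $\mathbf K$ to subsets of $X$ such that $\sigma(0)=\varnothing$; $\sigma(1)=X$; $\sigma(\bigoplus_{i} A_i)=\bigcup_{i}\sigma(A_i)$ for all set-indexed families; $\sigma(\Sigma A)=\sigma(A)$; $\sigma(A)\subseteq\sigma(B)\cup\sigma(C)$ for every distinguished triangle $A\to B\to C\to\Sigma A$; and $\Phi_\sigma(\mathbf I\otimes\mathbf J)=\Phi_\sigma(\mathbf I)\cap\Phi_\sigma(\mathbf J)$ for all thick ideals $\mathbf I,\mathbf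 J$ of $\mathbf K$, where $\Phi_\sigma(\mathcal S)=\bigcup_{A\in\mathcal S}\sigma(A)$. The faithfulness property is: for every $M\in\mathbf K$, $\Phi_\sigma(\langle\!\langle M\rangle\!\rangle)=\varnothing$ if and only if $M=0$. The realization property is: for every closed $W\subseteq X$ there is a compact $M$ with $\Phi_\sigma(\langle M\rangle)=W$. Theorem. Let $\mathbf K$ be a compactly generated M$\Delta$C and $\sigma$ an extended weak support datum on $\mathbf K$ with values in a Zariski space $X$, such that $\Phi_\sigma(\langle C\rangle)$ is closed for every compact object $C$. Then $\mathbf I\mapsto\Phi_\sigma(\mathbf I)$ maps thick ideals of $\mathbf K^c$ to $\mathcal X_{sp}$; $\Theta_\sigma(W)=\{M\in\mathbf K^c : \Phi_\sigma(\langle M\rangle)\subseteq W\}$ maps $\mathcal X_{sp}$ to thick ideals of $\mathbf K^c$; and $f_\sigma(x)=\{A\in\mathbf K^c : x\notin\Phi_\sigma(\langle A\rangle)\}$ defines a map $f_\sigma: X\to\operatorname{Spc}\mathbf K^c$, which is the unique continuous map with $f_\sigma^{-1}(V(A))=\Phi_\sigma(\langle A\rangle)$ for all $A\in\mathbf K^c$.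 Moreover: (a) If $\sigma$ has the faithfulness property, then $\Theta_\sigma\circ\Phi_\sigma=\operatorname{id}$. (b) If $\sigma$ has the realization property, then $\Phi_\sigma\circ\Theta_\sigma=\operatorname{id}$ and $f_\sigma$ is injective. (c) If $\sigma$ has both properties, then: (i) $\Phi_\sigma$ and $\Theta_\sigma$ are mutually inverse isomorphisms of ordered monoids, where the set of thick ideals of $\mathbf K^c$ carries the operation $\mathbf I,\mathbf J\mapsto\langle\mathbf I\otimes\mathbf J\rangle$ and inclusion, and $\mathcal X_{sp}$ carries intersection and inclusion; (ii) for every prime ideal $\mathbf P$ of $\mathbf K^c$ there is $x\in X$ with $\Phi_\sigma(\mathbf P)=(X\setminus\{x\})_{sp}$; (iii) $f_\sigma: X\to\operatorname{Spc}\mathbf K^c$ is a homeomorphism. -/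

import Mathlib

open CategoryTheory CategoryTheory.Limits CategoryTheory.Pretriangulated
open CategoryTheory.MonoidalCategory
open scoped ZeroObject

universe w v u

noncomputable section

namespace MonTri

/-! ### Topology: Zariski spaces and specialization-closed sets -/

section Topology

variable (X : Type w) [TopologicalSpace X]

/-- A Zariski space: a Noetherian topological space in which every irreducible closed subset
has a unique generic point. -/
structure IsZariskiSpace : Prop where
  noetherian : TopologicalSpace.NoetherianSpace X
  existsUnique_genericPoint : ∀ Z : Set X, IsIrreducible Z → IsClosed Z →
    ∃! x : X, IsGenericPoint x Z

variable {X}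

/-- Specialization-closed subsets: arbitrary unions of closed subsets. -/
def IsSpecializationClosed (W : Set X) : Prop :=
  ∃ S : Set (Set X), (∀ Z ∈ S, IsClosed Z) ∧ ⋃₀ S = W

lemma IsSpecializationClosed.inter {W W' : Set X} (h : IsSpecializationClosed W)
    (h' : IsSpecializationClosed W') : IsSpecializationClosed (W ∩ W') := by
  have h₁ := stableUnderSpecialization_iff_exists_sUnion_eq.2 h
  have h₂ := stableUnderSpecialization_iff_exists_sUnion_eq.2 h'
  exact stableUnderSpecialization_iff_exists_sUnion_eq.1
    (fun a b hab ha => ⟨h₁ hab ha.1, h₂ hab ha.2⟩)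

/-- The largest specialization-closed subset contained in `S`, that is, the union of all closed
subsets contained in `S`. -/
def specializationInterior (S : Set X) : Set X := ⋃₀ {Z : Set X | IsClosed Z ∧ Z ⊆ S}

variable (X)

/-- The set `𝒳_sp` of specialization-closed subsets of `X`. -/
def SpClosed : Type w := {W : Set X // IsSpecializationClosed W}

/-- `𝒳_sp` is ordered by inclusion. -/
instance : PartialOrder (SpClosed X) :=
  inferInstanceAs (PartialOrder {W : Set X // IsSpecializationClosed W})

/-- The operation on `𝒳_sp` is intersection. -/
instance : Mul (SpClosed X) := ⟨fun W W' => ⟨W.1 ∩ W'.1, W.2.inter W'.2⟩⟩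

end Topology

/-! ### Monoidal triangulated categories and compact objects -/

section Category

variable (K : Type u) [Category.{v} K] [MonoidalCategory K] [Preadditive K] [HasZeroObject K]
  [HasShift K ℤ] [∀ n : ℤ, (shiftFunctor K n).Additive] [Pretriangulated K]

variable {K} in
/-- `F` is an exact functor of triangulated categories: it commutes with the shift (up to a
natural isomorphism) and sends distinguished triangles to distinguished triangles. -/
def IsExactFunctor (F : K ⥤ K) : Prop :=
  ∃ _ : F.CommShift ℤ, F.IsTriangulated

/-- A monoidal triangulated category: the tensor product is an exact functor in each variable. -/
structure IsMonoidalTriangulated : Prop where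
  isTriangulated : IsTriangulated K
  exact_tensorLeft : ∀ A : K, IsExactFunctor (tensorLeft A)
  exact_tensorRight : ∀ A : K, IsExactFunctor (tensorRight A)

/-- The compact objects: those `C` for which the functor `K(C, -)`, with values in abelian groups,
commutes with set-indexed coproducts. -/
def compactObjects : ObjectProperty K := fun C =>
  ∀ J : Type v, PreservesColimitsOfShape (Discrete J) (preadditiveCoyoneda.obj (Opposite.op C))

/-- A compactly generated monoidal triangulated category. -/
structure IsCompactlyGenerated [HasCoproducts.{v} K] : Prop extends IsMonoidalTriangulated K where
  /-- the tensor product preserves set-indexed coproducts, in each variable -/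
  tensorLeft_coproducts : ∀ (A : K) (J : Type v),
    PreservesColimitsOfShape (Discrete J) (tensorLeft A)
  tensorRight_coproducts : ∀ (A : K) (J : Type v),
    PreservesColimitsOfShape (Discrete J) (tensorRight A)
  /-- the isomorphism classes of compact objects form a set -/
  essentiallySmall : ObjectProperty.EssentiallySmall.{v} (compactObjects K)
  /-- the compact objects detect non-zero objects -/
  generates : ∀ M : K, ¬ IsZero M → ∃ C : K, compactObjects K C ∧ ∃ f : C ⟶ M, f ≠ 0
  compact_tensor : ∀ C D : K, compactObjects K C → compactObjects K D → compactObjects K (C ⊗ D)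
  compact_unit : compactObjects K (𝟙_ K)
  /-- compact objects are rigid: they have duals on both sides -/
  rigid : ∀ C : K, compactObjects K C → Nonempty (HasLeftDual C) ∧ Nonempty (HasRightDual C)

end Category

/-! ### Thick ideals

In what follows `A` is a full monoidal triangulated subcategory of `K`, closed under direct
summands; it is applied to `A = ⊤` (that is, `K` itself) and to `A = compactObjects K`
(that is, `K^c`). -/

section Ideals

variable {K : Type u} [Category.{v} K] [MonoidalCategory K] [Preadditive K] [HasZeroObject K]
  [HasShift K ℤ] [∀ n : ℤ, (shiftFunctor K n).Additive] [Pretriangulated K]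

/-- Thick (two-sided) ideals of `A`: full triangulated subcategories of `A` that are closed under
direct summands (in a triangulated category these are the same as retracts), and under left and
right tensoring with arbitrary objects of `A`. -/
structure IsThickIdeal (A I : ObjectProperty K) : Prop where
  le : I ≤ A
  triangulated : I.IsTriangulated
  summands : I.IsStableUnderRetracts
  tensor_left : ∀ M N : K, A M → I N → I (M ⊗ N)
  tensor_right : ∀ M N : K, I M → A N → I (M ⊗ N)

/-- The smallest thick ideal of `A` containing `S`, for `S` a collection of objects of `A`. -/
def idealGen (A S : ObjectProperty K) : ObjectProperty K := fun M =>
  ∀ I : ObjectProperty K, IsThickIdeal A I → S ≤ I → I M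

/-- The smallest thick ideal of `A` containing the object `M` of `A`. -/
def principal (A : ObjectProperty K) (M : K) : ObjectProperty K := idealGen A (fun N => N = M)

/-- The collection `I ⊗ J` of objects isomorphic to some `M ⊗ N` with `M` in `I`, `N` in `J`. -/
def tensorCollection (I J : ObjectProperty K) : ObjectProperty K := fun L =>
  ∃ M N : K, I M ∧ J N ∧ Nonempty (L ≅ M ⊗ N)

lemma isThickIdeal_idealGen {A S : ObjectProperty K}
    (h : ∃ I, IsThickIdeal A I ∧ S ≤ I) : IsThickIdeal A (idealGen A S) := by
  obtain ⟨I₀, hI₀, hS₀⟩ := h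
  have hr : (idealGen A S).IsStableUnderRetracts :=
    ⟨fun r hY I hI hS => hI.summands.of_retract r (hY I hI hS)⟩
  refine ⟨fun M hM => hI₀.le _ (hM I₀ hI₀ hS₀), ?_, hr, ?_, ?_⟩
  · have hz : (idealGen A S).ContainsZero := by
      refine ⟨0, isZero_zero K, fun I hI hS => ?_⟩
      obtain ⟨Z, hZ, hIZ⟩ := hI.triangulated.toContainsZero.exists_zero
      exact hI.summands.of_retract ((isZero_zero K).retract Z) hIZ
    have hs : (idealGen A S).IsStableUnderShift ℤ := by
      refine ⟨fun n => ⟨fun M hM I hI hS => ?_⟩⟩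
      have := hI.triangulated
      exact I.le_shift n _ (hM I hI hS)
    have ht : (idealGen A S).IsTriangulatedClosed₂ := by
      refine ⟨fun T hT h₁ h₃ => ObjectProperty.le_isoClosure _ _ (fun I hI hS => ?_)⟩
      have := hI.triangulated
      have := hI.summands
      exact I.ext_of_isTriangulatedClosed₂ T hT (h₁ I hI hS) (h₃ I hI hS)
    exact { }
  · exact fun M N hM hN I hI hS => hI.tensor_left M N hM (hN I hI hS)
  · exact fun M N hM hN I hI hS => hI.tensor_right M N (hM I hI hS) hN

lemma IsThickIdeal.tensorCollection_le {A I J : ObjectProperty K} (hI : IsThickIdeal A I)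
    (hJ : IsThickIdeal A J) : tensorCollection I J ≤ I := by
  rintro L ⟨M, N, hM, hN, ⟨e⟩⟩
  exact hI.summands.of_retract e.retract (hI.tensor_right M N hM (hJ.le _ hN))

/-- The set of thick ideals of `A`. -/
def ThickId (A : ObjectProperty K) : Type u := {I : ObjectProperty K // IsThickIdeal A I}

/-- Thick ideals are ordered by inclusion. -/
instance (A : ObjectProperty K) : PartialOrder (ThickId A) :=
  inferInstanceAs (PartialOrder {I : ObjectProperty K // IsThickIdeal A I})

/-- The operation `I, J ↦ ⟨I ⊗ J⟩` on thick ideals. -/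
instance (A : ObjectProperty K) : Mul (ThickId A) :=
  ⟨fun I J => ⟨idealGen A (tensorCollection I.1 J.1),
    isThickIdeal_idealGen ⟨I.1, I.2, I.2.tensorCollection_le J.2⟩⟩⟩

/-- Prime ideals of `A`: proper thick ideals `P` such that `I ⊗ J ⊆ P` implies `I ⊆ P` or `J ⊆ P`
for all thick ideals `I`, `J` of `A`. -/
structure IsPrimeIdeal (A P : ObjectProperty K) : Prop where
  thick : IsThickIdeal A P
  proper : P ≠ A
  prime : ∀ I J : ObjectProperty K, IsThickIdeal A I → IsThickIdeal A J →
    tensorCollection I J ≤ P → I ≤ P ∨ J ≤ P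

/-- The noncommutative Balmer spectrum of `A`, the set of its prime ideals. -/
def Spc (A : ObjectProperty K) : Type u := {P : ObjectProperty K // IsPrimeIdeal A P}

/-- `V(S)` is the set of prime ideals that contain no object of `S`. -/
def V (A S : ObjectProperty K) : Set (Spc A) := {P | ∀ M : K, S M → ¬ P.1 M}

/-- The Zariski topology on the Balmer spectrum: the topology generated by the closed sets `V(S)`,
for all collections `S` of objects of `A`. -/
instance (A : ObjectProperty K) : TopologicalSpace (Spc A) :=
  TopologicalSpace.generateFrom {U | ∃ S : ObjectProperty K, S ≤ A ∧ U = (V A S)ᶜ}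

end Ideals

/-! ### Support data -/

section Support

variable {K : Type u} [Category.{v} K] [MonoidalCategory K] [Preadditive K] [HasZeroObject K]
  [HasShift K ℤ] [∀ n : ℤ, (shiftFunctor K n).Additive] [Pretriangulated K]
  {X : Type w}

/-- `Φ_σ(S)`, the union of the sets `σ(M)` for `M` in `S`. -/
def Phi (σ : K → Set X) (S : ObjectProperty K) : Set X := ⋃ (M : K) (_ : S M), σ M

/-- Extended weak support data on `K` with values in subsets of `X`. -/
structure IsExtendedWeakSupportDatum [HasCoproducts.{v} K] (σ : K → Set X) : Prop where
  zero : σ 0 = ∅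
  unit : σ (𝟙_ K) = Set.univ
  coproduct : ∀ (J : Type v) (M : J → K), σ (∐ M) = ⋃ j, σ (M j)
  shift : ∀ M : K, σ (M⟦(1 : ℤ)⟧) = σ M
  triangle : ∀ T : Triangle K, T ∈ distTriang K → σ T.obj₁ ⊆ σ T.obj₂ ∪ σ T.obj₃
  tensor : ∀ I J : ObjectProperty K, IsThickIdeal ⊤ I → IsThickIdeal ⊤ J →
    Phi σ (tensorCollection I J) = Phi σ I ∩ Phi σ J

/-- The faithfulness property: `Φ_σ` of the thick ideal of `K` generated by `M` is empty if and
only if `M = 0`. -/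
def Faithful (σ : K → Set X) : Prop :=
  ∀ M : K, Phi σ (principal ⊤ M) = ∅ ↔ IsZero M

/-- The realization property: every closed subset of `X` is `Φ_σ` of the thick ideal of `K^c`
generated by some compact object. -/
def Realizing [TopologicalSpace X] (σ : K → Set X) : Prop :=
  ∀ W : Set X, IsClosed W →
    ∃ M : K, compactObjects K M ∧ Phi σ (principal (compactObjects K) M) = W

/-- `Θ_σ(W)`, the collection of compact objects `M` with `Φ_σ(⟨M⟩) ⊆ W`. -/
def Theta (σ : K → Set X) (W : Set X) : ObjectProperty K := fun M =>
  compactObjects K M ∧ Phi σ (principal (compactObjects K) M) ⊆ W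

/-- `f_σ(x)`, the collection of compact objects `M` with `x ∉ Φ_σ(⟨M⟩)`. -/
def fIdeal (σ : K → Set X) (x : X) : ObjectProperty K := fun M =>
  compactObjects K M ∧ x ∉ Phi σ (principal (compactObjects K) M)

end Support

end MonTri

end

/-!
Write `K^c` for the compact objects, `Loc(I)` for the localizing subcategory generated by a thick
ideal `I` of `K^c`, and `⟪L⟫` for the thick ideal of `K` generated by `L`. The tensor axiom for `σ`
concerns thick ideals of `K`, whereas the theorem is about thick ideals of `K^c`; the passage
between the two is through `Loc(I)`.

Compact generation implies that a localizing subcategory containing `K^c` is everything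
(`IsLocalizing.prop_of_compactObjects_le`). Therefore a condition on `A ⊗ X` that defines a
localizing subcategory needs to be checked only for compact `A`. It follows that `Loc(I)` is an
ideal of `K`, that, by rigidity of the compact objects, so is the right orthogonal of `I`, and that
`Φ(Loc(I)) = Φ(I)` (`Phi_locGen`). The tensor axiom for `Loc(I)` and `Loc(J)` then yields
`Φ(I ⊗ J) = Φ(I) ∩ Φ(J)` (`Phi_tensorCollection`), which makes `f_σ(x)` prime and `Φ`
multiplicative.

The main point is `Theta_Phi_of_faithful`. If `M` is compact with `Φ(⟨M⟩) ⊆ Φ(I)`, take the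
localization triangle `Γ ⟶ M ⟶ L` with `Γ` in `Loc(I)` and `L` right orthogonal to `I`
(`exists_localization_triangle`). Then `Φ(⟪L⟫) ⊆ Φ(I) = Φ(Loc(I))` by the triangle, and
`Φ(⟪L⟫) ∩ Φ(Loc(I)) = Φ(⟪L⟫ ⊗ Loc(I)) = ∅`, since the objects of `⟪L⟫ ⊗ Loc(I)` are both in
`Loc(I)` and right orthogonal to `I`, hence zero. By faithfulness `L = 0`, so `M` is a compact
object of `Loc(I)`, and such objects are in `I` (`prop_of_compact_of_locGen`).

With realization, closed sets are supports of thick ideals, and `Φ`, `Θ` are mutually inverse.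
A prime ideal then corresponds to a meet-prime specialization-closed set `W`; a minimal closed set
not contained in `W` is irreducible, and its generic point `x` satisfies `W = (X ∖ {x})_sp`
(`IsZariskiSpace.exists_eq_specializationInterior`). This gives surjectivity of `f_σ`, and `f_σ` is
closed because it maps `Φ(⟨M⟩)` onto `V(M)`.
-/

namespace MonTri

/-! ### Compactness in terms of finite sums of morphisms -/

section CompactHoms

variable {K : Type u} [Category.{v} K] [Preadditive K] [HasCoproducts.{v} K]

open Classical in
/-- The morphisms to a coproduct that are finite sums of morphisms through its summands; the
condition is stated with the components `f ≫ Sigma.π X j`, which makes it visibly additive. -/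
noncomputable def finiteSumHoms (C : K) {J : Type v} (X : J → K) : AddSubgroup (C ⟶ ∐ X) where
  carrier := {f | ∃ s : Finset J, ∀ t : Finset J, s ⊆ t →
    f = ∑ j ∈ t, (f ≫ Sigma.π X j) ≫ Sigma.ι X j}
  add_mem' := by
    rintro f g ⟨s, hs⟩ ⟨t, ht⟩
    refine ⟨s ∪ t, fun r hr => ?_⟩
    simp only [Preadditive.add_comp, Finset.sum_add_distrib]
    rw [← hs r (Finset.union_subset_left hr), ← ht r (Finset.union_subset_right hr)]
  zero_mem' := ⟨∅, fun t _ => by simp⟩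
  neg_mem' := by
    rintro f ⟨s, hs⟩
    refine ⟨s, fun r hr => ?_⟩
    simp only [Preadditive.neg_comp, Finset.sum_neg_distrib]
    rw [← hs r hr]

lemma comp_ι_mem_finiteSumHoms {C : K} {J : Type v} (X : J → K) (j : J) (g : C ⟶ X j) :
    g ≫ Sigma.ι X j ∈ finiteSumHoms C X := by
  classical
  refine ⟨{j}, fun t ht => ?_⟩
  rw [Finset.sum_eq_single j]
  · simp [Category.assoc]
  · intro i _ hi
    simp [Category.assoc, Sigma.ι_π_of_ne X hi.symm]
  · intro hj
    exact absurd (ht (by simp)) hj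

lemma sum_comp_ι_mem_finiteSumHoms {C : K} {J : Type v} (X : J → K) (s : Finset J)
    (g : ∀ j, C ⟶ X j) : ∑ j ∈ s, g j ≫ Sigma.ι X j ∈ finiteSumHoms C X :=
  sum_mem (fun j _ => comp_ι_mem_finiteSumHoms X j (g j))

lemma exists_eq_sum_of_mem {C : K} {J : Type v} {X : J → K} {f : C ⟶ ∐ X}
    (hf : f ∈ finiteSumHoms C X) :
    ∃ (s : Finset J) (g : ∀ j, C ⟶ X j), f = ∑ j ∈ s, g j ≫ Sigma.ι X j := by
  obtain ⟨s, hs⟩ := hf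
  exact ⟨s, _, hs s subset_rfl⟩

lemma comp_mem_finiteSumHoms {C D : K} {J : Type v} {X : J → K} (g : D ⟶ C) {f : C ⟶ ∐ X}
    (hf : f ∈ finiteSumHoms C X) : g ≫ f ∈ finiteSumHoms D X := by
  obtain ⟨s, f', hs⟩ := exists_eq_sum_of_mem hf
  rw [hs, Preadditive.comp_sum]
  simp only [← Category.assoc g]
  exact sum_comp_ι_mem_finiteSumHoms X s _

/-- `C` is compact if and only if every morphism from `C` to a coproduct is a finite sum of
morphisms through the summands. -/
lemma compactObjects_iff [HasZeroObject K] [HasShift K ℤ]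
    [∀ n : ℤ, (shiftFunctor K n).Additive] [Pretriangulated K] [MonoidalCategory K] (C : K) :
    compactObjects K C ↔ ∀ (J : Type v) (X : J → K) (f : C ⟶ ∐ X), f ∈ finiteSumHoms C X := by
  classical
  constructor
  · intro hC J X f
    have := hC J
    let F := preadditiveCoyoneda.obj (Opposite.op C)
    have hcol := isColimitOfHasCoproductOfPreservesColimit F X
    let H := finiteSumHoms C X
    let q : F.obj (∐ X) ⟶ AddCommGrpCat.of ((C ⟶ ∐ X) ⧸ H) :=
      AddCommGrpCat.ofHom (QuotientAddGroup.mk' H)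
    -- `q` vanishes on each `Hom(C, X j)`, and these generate the coproduct `Hom(C, ∐ X)`
    have hq : q = 0 := by
      refine Cofan.IsColimit.hom_ext hcol _ _ (fun j => ?_)
      ext (g : C ⟶ X j)
      exact (QuotientAddGroup.eq_zero_iff _).2 (comp_ι_mem_finiteSumHoms X j g)
    have hf : (q.hom : _ → _) f = 0 := by rw [hq]; rfl
    exact (QuotientAddGroup.eq_zero_iff _).1 hf
  · intro h J
    suffices ∀ X : J → K, PreservesColimit (Discrete.functor X)
      (preadditiveCoyoneda.obj (Opposite.op C)) from preservesColimitsOfShape_of_discrete _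
    intro X
    refine preservesColimit_of_preserves_colimit_cocone (coproductIsCoproduct X) ?_
    refine (isColimitMapCoconeCofanMkEquiv _ _ _).symm ?_
    have hfin : ∀ (s : Cofan fun j => (preadditiveCoyoneda.obj (Opposite.op C)).obj (X j))
        (f : C ⟶ ∐ X), (Function.support fun j => (s.inj j).hom (f ≫ Sigma.π X j)).Finite := by
      intro s f
      obtain ⟨t, ht⟩ := h J X f
      refine t.finite_toSet.subset (fun j hj => ?_)
      by_contra hjt
      refine hj ?_
      have : f ≫ Sigma.π X j = 0 := by
        rw [ht t subset_rfl, Preadditive.sum_comp]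
        refine Finset.sum_eq_zero (fun i hi => ?_)
        have hij : i ≠ j := fun e => hjt (by simpa [← e] using hi)
        simp [Sigma.ι_π_of_ne X hij]
      change (s.inj j).hom (f ≫ Sigma.π X j) = 0
      rw [this]
      exact map_zero _
    have hadd : ∀ (s : Cofan fun j => (preadditiveCoyoneda.obj (Opposite.op C)).obj (X j))
        (f g : C ⟶ ∐ X), ∑ᶠ j, (s.inj j).hom ((f + g) ≫ Sigma.π X j) =
          ∑ᶠ j, (s.inj j).hom (f ≫ Sigma.π X j) + ∑ᶠ j, (s.inj j).hom (g ≫ Sigma.π X j) := by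
      intro s f g
      rw [← finsum_add_distrib (hfin s f) (hfin s g)]
      refine finsum_congr (fun j => ?_)
      rw [Preadditive.add_comp]
      exact map_add (s.inj j).hom _ _
    refine Cofan.IsColimit.mk _ (fun s => AddCommGrpCat.ofHom (AddMonoidHom.mk'
      (fun f : C ⟶ ∐ X => ∑ᶠ j, (s.inj j).hom (f ≫ Sigma.π X j)) (hadd s))) ?_ ?_
    · intro s j
      ext (g : C ⟶ X j)
      change ∑ᶠ i, (s.inj i).hom ((g ≫ Sigma.ι X j) ≫ Sigma.π X i) = (s.inj j).hom g
      rw [finsum_eq_single _ j]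
      · simp
      · intro i hi
        rw [Category.assoc, Sigma.ι_π_of_ne X hi.symm, comp_zero]
        exact map_zero _
    · intro s m hm
      ext (f : C ⟶ ∐ X)
      change m.hom f = ∑ᶠ i, (s.inj i).hom (f ≫ Sigma.π X i)
      obtain ⟨t, ht⟩ := h J X f
      have hm' : ∀ (j : J) (g : C ⟶ X j), m.hom (g ≫ Sigma.ι X j) = (s.inj j).hom g :=
        fun j g => ConcreteCategory.congr_hom (hm j) g
      have hsub : (Function.support fun j => (s.inj j).hom (f ≫ Sigma.π X j)) ⊆
          ((t ∪ (hfin s f).toFinset : Finset J) : Set J) := by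
        intro j hj
        simp only [Finset.coe_union, Set.Finite.coe_toFinset]
        exact Or.inr hj
      rw [finsum_eq_sum_of_support_subset _ hsub]
      conv_lhs => rw [ht (t ∪ (hfin s f).toFinset) Finset.subset_union_left]
      refine (map_sum m.hom _ _).trans ?_
      exact Finset.sum_congr rfl (fun j _ => hm' j _)

end CompactHoms

/-! ### The compact objects form a thick subcategory -/

section CompactClosure

variable {K : Type u} [Category.{v} K] [MonoidalCategory K] [Preadditive K] [HasZeroObject K]
  [HasShift K ℤ] [∀ n : ℤ, (shiftFunctor K n).Additive] [Pretriangulated K] [HasCoproducts.{v} K]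

/-- A left adjoint preserves compactness if its right adjoint is additive and preserves
coproducts. -/
lemma compactObjects_of_adjunction {L R : K ⥤ K} (adj : L ⊣ R) [R.Additive]
    (hR : ∀ J : Type v, PreservesColimitsOfShape (Discrete J) R) {C : K}
    (hC : compactObjects K C) : compactObjects K (L.obj C) := by
  have hL : L.Additive := adj.left_adjoint_additive
  rw [compactObjects_iff] at hC ⊢
  intro J X f
  have := hR J
  let e := PreservesCoproduct.iso R X
  obtain ⟨s, g, hs⟩ := exists_eq_sum_of_mem (hC J _ (adj.homEquiv _ _ f ≫ e.hom))
  have h₁ : adj.homEquiv _ _ f = ∑ j ∈ s, g j ≫ R.map (Sigma.ι X j) := by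
    rw [← cancel_mono e.hom, hs, Preadditive.sum_comp]
    refine Finset.sum_congr rfl (fun j _ => ?_)
    have h : R.map (Sigma.ι X j) ≫ e.hom = Sigma.ι (fun j => R.obj (X j)) j := by
      rw [← Iso.eq_comp_inv]
      simp [e]
    rw [Category.assoc, h]
  have h₂ : f = ∑ j ∈ s, (adj.homEquiv _ _).symm (g j) ≫ Sigma.ι X j := by
    apply (adj.homEquiv _ _).injective
    rw [h₁]
    symm
    refine (map_sum (adj.homAddEquiv C (∐ X)) _ _).trans ?_
    refine Finset.sum_congr rfl (fun j _ => ?_)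
    simp [Adjunction.homEquiv_naturality_right]
  rw [h₂]
  exact sum_comp_ι_mem_finiteSumHoms X s _

lemma compactObjects_of_retract {C D : K} (r : Retract C D) (hD : compactObjects K D) :
    compactObjects K C := by
  rw [compactObjects_iff] at hD ⊢
  intro J X f
  have := comp_mem_finiteSumHoms r.i (hD J X (r.r ≫ f))
  rwa [r.retract_assoc] at this

instance : (compactObjects K).IsStableUnderRetracts := ⟨compactObjects_of_retract⟩

instance : (compactObjects K).IsTriangulated := by
  have hz : (compactObjects K).ContainsZero := by
    refine ⟨0, isZero_zero K, ?_⟩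
    rw [compactObjects_iff]
    intro J X f
    rw [(isZero_zero K).eq_zero_of_src f]
    exact zero_mem _
  have hs : (compactObjects K).IsStableUnderShift ℤ :=
    ⟨fun n => ⟨fun C hC => by
      have : (shiftEquiv' K n (-n) (add_neg_cancel n)).inverse.Additive :=
        inferInstanceAs (shiftFunctor K (-n)).Additive
      exact compactObjects_of_adjunction
        (shiftEquiv' K n (-n) (add_neg_cancel n)).toAdjunction
        (fun J => inferInstance) hC⟩⟩
  have ht : (compactObjects K).IsTriangulatedClosed₂ := by
    refine .mk' (fun T hT h₁ h₃ => ?_)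
    classical
    rw [compactObjects_iff] at h₁ h₃ ⊢
    intro J X f
    -- on `T.obj₁` only finitely many components of `f` are non-zero; they form `f'`
    obtain ⟨s, hs⟩ := h₁ J X (T.mor₁ ≫ f)
    let f' := ∑ j ∈ s, (f ≫ Sigma.π X j) ≫ Sigma.ι X j
    have hf : T.mor₁ ≫ (f - f') = 0 := by
      simp only [f', Preadditive.comp_sub, Preadditive.comp_sum, sub_eq_zero]
      conv_lhs => rw [hs s subset_rfl]
      simp
    obtain ⟨g, hg⟩ := T.yoneda_exact₂ hT _ hf
    rw [← sub_add_cancel f f', hg]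
    exact add_mem (comp_mem_finiteSumHoms _ (h₃ J X g)) (sum_comp_ι_mem_finiteSumHoms X s _)
  exact { }

end CompactClosure

/-! ### Localizing subcategories -/

section Shift

variable {K : Type u} [Category.{v} K] [Preadditive K] [HasShift K ℤ]
  [∀ n : ℤ, (shiftFunctor K n).Additive]

/-- A left cancellation property of `φ` on morphisms from `C⟦-1⟧` gives the same property of
`φ⟦1⟧'` on morphisms from `C`. -/
lemma eq_zero_of_comp_shift_eq_zero {A B C : K} (φ : A ⟶ B)
    (h : ∀ x : C⟦(-1 : ℤ)⟧ ⟶ A, x ≫ φ = 0 → x = 0) (x : C ⟶ A⟦(1 : ℤ)⟧)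
    (hx : x ≫ φ⟦(1 : ℤ)⟧' = 0) : x = 0 := by
  have h₁ : x⟦(-1 : ℤ)⟧' ≫ (shiftShiftNeg A (1 : ℤ)).hom = 0 := by
    refine h _ ?_
    have h₂ : x⟦(-1 : ℤ)⟧' ≫ φ⟦(1 : ℤ)⟧'⟦(-1 : ℤ)⟧' = 0 := by
      rw [← Functor.map_comp, hx, Functor.map_zero]
    rw [shift_shift_neg'] at h₂
    rw [← cancel_mono ((shiftFunctorCompIsoId K (1 : ℤ) (-1) (add_neg_cancel 1)).inv.app B),
      zero_comp, Category.assoc, Category.assoc]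
    exact h₂
  apply (shiftFunctor K (-1 : ℤ)).map_injective
  rw [← cancel_mono (shiftShiftNeg A (1 : ℤ)).hom, h₁, Functor.map_zero, zero_comp]

end Shift

section Localizing

variable {K : Type u} [Category.{v} K] [Preadditive K] [HasZeroObject K]
  [HasShift K ℤ] [∀ n : ℤ, (shiftFunctor K n).Additive] [Pretriangulated K] [HasCoproducts.{v} K]

/-- Localizing subcategories: full triangulated subcategories closed under retracts and
set-indexed coproducts. -/
structure IsLocalizing (S : ObjectProperty K) : Prop where
  triangulated : S.IsTriangulated
  summands : S.IsStableUnderRetracts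
  coproduct : ∀ (J : Type v) (M : J → K), (∀ j, S (M j)) → S (∐ M)

/-- The smallest localizing subcategory containing `I`. -/
def locGen (I : ObjectProperty K) : ObjectProperty K := fun M =>
  ∀ S : ObjectProperty K, IsLocalizing S → I ≤ S → S M

lemma le_locGen (I : ObjectProperty K) : I ≤ locGen I := fun _ hM _ _ hS => hS _ hM

lemma isLocalizing_locGen (I : ObjectProperty K) : IsLocalizing (locGen I) := by
  have hr : (locGen I).IsStableUnderRetracts :=
    ⟨fun r hY S hS hI => hS.summands.of_retract r (hY S hS hI)⟩
  refine ⟨?_, hr, fun J M hM S hS hI => hS.coproduct J M (fun j => hM j S hS hI)⟩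
  have hz : (locGen I).ContainsZero := by
    refine ⟨0, isZero_zero K, fun S hS hI => ?_⟩
    obtain ⟨Z, hZ, hSZ⟩ := hS.triangulated.toContainsZero.exists_zero
    exact hS.summands.of_retract ((isZero_zero K).retract Z) hSZ
  have hs : (locGen I).IsStableUnderShift ℤ := by
    refine ⟨fun n => ⟨fun M hM S hS hI => ?_⟩⟩
    have := hS.triangulated
    exact S.le_shift n _ (hM S hS hI)
  have ht : (locGen I).IsTriangulatedClosed₂ := by
    refine .mk' (fun T hT h₁ h₃ S hS hI => ?_)
    have := hS.triangulated
    have := hS.summands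
    exact S.ext_of_isTriangulatedClosed₂ T hT (h₁ S hS hI) (h₃ S hS hI)
  exact { }

lemma IsLocalizing.inverseImage {S : ObjectProperty K} (hS : IsLocalizing S) {F : K ⥤ K}
    (hF : IsExactFunctor F) (hc : ∀ J : Type v, PreservesColimitsOfShape (Discrete J) F) :
    IsLocalizing (S.inverseImage F) := by
  obtain ⟨_, _⟩ := hF
  have := hS.triangulated
  have := hS.summands
  refine ⟨inferInstance, ⟨fun r hY => hS.summands.of_retract (r.map F) hY⟩, fun J M hM => ?_⟩
  have := hc J
  exact S.prop_of_iso (PreservesCoproduct.iso F M).symm (hS.coproduct J _ hM)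

end Localizing

/-! ### Compact objects of a compactly generated localizing subcategory -/

section Neeman

variable {K : Type u} [Category.{v} K] [MonoidalCategory K] [Preadditive K] [HasZeroObject K]
  [HasShift K ℤ] [∀ n : ℤ, (shiftFunctor K n).Additive] [Pretriangulated K] [HasCoproducts.{v} K]

lemma compactObjects_of_trW {I : ObjectProperty K} (hI : I ≤ compactObjects K)
    {N C : K} {s : N ⟶ C} (hs : I.trW s) (hC : compactObjects K C) : compactObjects K N := by
  obtain ⟨Z, g, h, hT, hZ⟩ := hs
  exact (compactObjects K).ext_of_isTriangulatedClosed₁ _ hT hC (hI _ hZ)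

/-- The objects `X` such that every morphism from a compact object to `X` is annihilated by a
morphism whose cone lies in `I`. -/
def annihilated (I : ObjectProperty K) : ObjectProperty K := fun X =>
  ∀ (C : K) (_ : compactObjects K C) (f : C ⟶ X), ∃ (N : K) (s : N ⟶ C), I.trW s ∧ s ≫ f = 0

/-- Closure under coproducts uses that a morphism from a compact object to a coproduct has finitely
many components, which can be annihilated one after the other. -/
lemma isLocalizing_annihilated [IsTriangulated K] {I : ObjectProperty K} [I.IsTriangulated]
    (hI : I ≤ compactObjects K) : IsLocalizing (annihilated I) := by
  classical
  have hr : (annihilated I).IsStableUnderRetracts := by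
    refine ⟨fun {X Y} r hY C hC f => ?_⟩
    obtain ⟨N, s, hs, h⟩ := hY C hC (f ≫ r.i)
    refine ⟨N, s, hs, ?_⟩
    simpa using h =≫ r.r
  refine ⟨?_, hr, fun J M hM C hC f => ?_⟩
  · have hz : (annihilated I).ContainsZero := by
      refine ⟨0, isZero_zero K, fun C hC f => ⟨C, 𝟙 C, MorphismProperty.id_mem _ _, ?_⟩⟩
      exact (isZero_zero K).eq_of_tgt _ _
    have hs : (annihilated I).IsStableUnderShift ℤ := by
      refine ⟨fun n => ⟨fun X hX C hC f => ?_⟩⟩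
      obtain ⟨N, s, hs, h⟩ := hX (C⟦-n⟧) ((compactObjects K).le_shift (-n) _ hC)
        (f⟦-n⟧' ≫ (shiftShiftNeg X n).hom)
      refine ⟨N⟦n⟧, s⟦n⟧' ≫ (shiftNegShift C n).hom, ?_, ?_⟩
      · exact MorphismProperty.RespectsIso.postcomp _ _ _ (hs.shift n)
      · have h' : s ≫ f⟦-n⟧' = 0 := by
          rw [← cancel_mono (shiftShiftNeg X n).hom, Category.assoc, h, zero_comp]
        have h'' : s⟦n⟧' ≫ f⟦-n⟧'⟦n⟧' = 0 := by
          rw [← Functor.map_comp, h', Functor.map_zero]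
        rw [shift_neg_shift'] at h''
        rw [← cancel_mono ((shiftFunctorCompIsoId K (-n) n (neg_add_cancel n)).inv.app _),
          zero_comp, Category.assoc, Category.assoc]
        exact h''
    have ht : (annihilated I).IsTriangulatedClosed₂ := by
      refine .mk' (fun T hT h₁ h₃ C hC f => ?_)
      obtain ⟨N, s, hs, h⟩ := h₃ C hC (f ≫ T.mor₂)
      obtain ⟨g, hg⟩ := T.coyoneda_exact₂ hT (s ≫ f) (by simpa using h)
      obtain ⟨N', s', hs', h'⟩ := h₁ N (compactObjects_of_trW hI hs hC) g
      refine ⟨N', s' ≫ s, MorphismProperty.comp_mem _ _ _ hs' hs, ?_⟩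
      rw [Category.assoc, hg, reassoc_of% h', zero_comp]
    exact { }
  · obtain ⟨t, g, ht⟩ := exists_eq_sum_of_mem ((compactObjects_iff C).1 hC J M f)
    have key : ∀ t : Finset J, ∃ (N : K) (s : N ⟶ C), I.trW s ∧ ∀ j ∈ t, s ≫ g j = 0 := by
      intro t
      induction t using Finset.induction_on with
      | empty => exact ⟨C, 𝟙 C, MorphismProperty.id_mem _ _, by simp⟩
      | insert j t hj ih =>
        obtain ⟨N, s, hs, h⟩ := ih
        obtain ⟨N', s', hs', h'⟩ := hM j N (compactObjects_of_trW hI hs hC) (s ≫ g j)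
        refine ⟨N', s' ≫ s, MorphismProperty.comp_mem _ _ _ hs' hs, fun i hi => ?_⟩
        rcases Finset.mem_insert.1 hi with rfl | hi
        · simpa using h'
        · rw [Category.assoc, h i hi, comp_zero]
    obtain ⟨N, s, hs, h⟩ := key t
    refine ⟨N, s, hs, ?_⟩
    rw [ht, Preadditive.comp_sum]
    refine Finset.sum_eq_zero (fun j hj => ?_)
    rw [← Category.assoc, h j hj, zero_comp]

/-- The compact objects of the localizing subcategory generated by a thick subcategory `I` of
compact objects are the objects of `I` (Neeman): a morphism `N ⟶ M` with cone in `I` that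
annihilates the identity of `M` is zero, hence `M` is a retract of its cone. -/
lemma prop_of_compact_of_locGen [IsTriangulated K] {I : ObjectProperty K} [I.IsTriangulated]
    [I.IsStableUnderRetracts] (hI : I ≤ compactObjects K) {M : K} (hM : compactObjects K M)
    (h : locGen I M) : I M := by
  have hle : I ≤ annihilated I := by
    intro X hX C hC f
    obtain ⟨N, s, c, hT⟩ := distinguished_cocone_triangle₁ f
    exact ⟨N, s, ⟨X, f, c, hT, hX⟩, comp_distTriang_mor_zero₁₂ _ hT⟩
  obtain ⟨N, s, ⟨Z, g, c, hT, hZ⟩, hs⟩ :=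
    h _ (isLocalizing_annihilated hI) hle M hM (𝟙 M)
  rw [Category.comp_id] at hs
  have : Mono g := Triangle.mono₂ _ hT hs
  have := isSplitMono_of_mono g
  exact I.prop_of_retract ⟨g, retraction g, by simp⟩ hZ

end Neeman

/-! ### Homotopy colimits of sequences -/

section Telescope

variable {K : Type u} [Category.{v} K] [Preadditive K] [HasCoproducts.{v} K]

/-- The coproduct of the terms of a sequence of objects, indexed by a copy of `ℕ` in the universe
for which coproducts exist. -/
noncomputable abbrev sigmaNat (X : ℕ → K) : K := ∐ fun n : ULift.{v} ℕ => X n.down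

/-- The inclusion of a term of the sequence in the coproduct. -/
noncomputable abbrev sigmaNatι (X : ℕ → K) (n : ℕ) : X n ⟶ sigmaNat X :=
  Sigma.ι (fun n : ULift.{v} ℕ => X n.down) ⟨n⟩

/-- The morphism `1 - shift` on the coproduct of a sequence, whose cone is the homotopy colimit
of the sequence. -/
noncomputable def oneSubShift (X : ℕ → K) (t : ∀ n, X n ⟶ X (n + 1)) : sigmaNat X ⟶ sigmaNat X :=
  Sigma.desc (fun n => sigmaNatι X n.down - t n.down ≫ sigmaNatι X (n.down + 1))

lemma ι_oneSubShift (X : ℕ → K) (t : ∀ n, X n ⟶ X (n + 1)) (n : ℕ) :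
    sigmaNatι X n ≫ oneSubShift X t = sigmaNatι X n - t n ≫ sigmaNatι X (n + 1) := by
  simp [oneSubShift, sigmaNatι]

lemma ι_comp_eq_of_oneSubShift_comp_eq_zero {X : ℕ → K} {t : ∀ n, X n ⟶ X (n + 1)} {H : K}
    {p : sigmaNat X ⟶ H} (h : oneSubShift X t ≫ p = 0) (n : ℕ) :
    sigmaNatι X n ≫ p = t n ≫ sigmaNatι X (n + 1) ≫ p := by
  have h' := sigmaNatι X n ≫= h
  rwa [← Category.assoc, ι_oneSubShift, comp_zero, Preadditive.sub_comp, Category.assoc,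
    sub_eq_zero] at h'

variable [MonoidalCategory K] [HasZeroObject K] [HasShift K ℤ]
  [∀ n : ℤ, (shiftFunctor K n).Additive] [Pretriangulated K]
  {X : ℕ → K} {t : ∀ n, X n ⟶ X (n + 1)}

/-- The morphism `1 - shift` is injective on morphisms from a compact object: the components of
`x` vanish by induction. -/
lemma eq_zero_of_comp_oneSubShift {C : K} (hC : compactObjects K C) (x : C ⟶ sigmaNat X)
    (hx : x ≫ oneSubShift X t = 0) : x = 0 := by
  classical
  let p := fun n : ℕ => Sigma.π (fun n : ULift.{v} ℕ => X n.down) ⟨n⟩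
  have hp : ∀ n, sigmaNatι X n ≫ p n = 𝟙 _ := fun n => Sigma.ι_π_eq_id _ _
  have hp' : ∀ m n, m ≠ n → sigmaNatι X m ≫ p n = 0 := fun m n h =>
    Sigma.ι_π_of_ne _ (by simpa using h)
  have h₀ : oneSubShift X t ≫ p 0 = p 0 := by
    refine Sigma.hom_ext _ _ (fun ⟨n⟩ => ?_)
    change sigmaNatι X n ≫ _ = sigmaNatι X n ≫ _
    rw [← Category.assoc, ι_oneSubShift, Preadditive.sub_comp, Category.assoc,
      hp' (n + 1) 0 (by omega), comp_zero, sub_zero]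
  have h₁ : ∀ m, oneSubShift X t ≫ p (m + 1) = p (m + 1) - p m ≫ t m := by
    intro m
    refine Sigma.hom_ext _ _ (fun ⟨n⟩ => ?_)
    change sigmaNatι X n ≫ _ = sigmaNatι X n ≫ _
    rw [← Category.assoc, ι_oneSubShift, Preadditive.sub_comp, Category.assoc,
      Preadditive.comp_sub]
    congr 1
    by_cases h : n = m
    · subst h
      rw [hp, reassoc_of% (hp n), Category.comp_id]
    · rw [hp' (n + 1) (m + 1) (by omega), reassoc_of% (hp' n m h), zero_comp, comp_zero]
  have hz : ∀ n, x ≫ p n = 0 := by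
    intro n
    induction n with
    | zero => rw [← h₀, reassoc_of% hx, zero_comp]
    | succ n ih =>
      have : x ≫ oneSubShift X t ≫ p (n + 1) = 0 := by rw [reassoc_of% hx, zero_comp]
      rwa [h₁, Preadditive.comp_sub, reassoc_of% ih, zero_comp, sub_zero] at this
  obtain ⟨s, hs⟩ := (compactObjects_iff C).1 hC _ _ x
  rw [hs s subset_rfl]
  refine Finset.sum_eq_zero (fun n _ => ?_)
  refine (congrArg (· ≫ sigmaNatι X n.down) ?_).trans zero_comp
  convert hz n.down

/-- A morphism from a compact object to a homotopy colimit factors through a term of the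
sequence. -/
lemma exists_factorization_hocolim {C H : K} (hC : compactObjects K C)
    {p : sigmaNat X ⟶ H} {δ : H ⟶ (sigmaNat X)⟦(1 : ℤ)⟧}
    (hT : Triangle.mk (oneSubShift X t) p δ ∈ distTriang K) (f : C ⟶ H) :
    ∃ (n : ℕ) (g : C ⟶ X n), f = g ≫ sigmaNatι X n ≫ p := by
  have hp : ∀ n, sigmaNatι X n ≫ p = t n ≫ sigmaNatι X (n + 1) ≫ p :=
    ι_comp_eq_of_oneSubShift_comp_eq_zero (comp_distTriang_mor_zero₁₂ _ hT)
  have hle : ∀ m n, m ≤ n → ∃ a : X m ⟶ X n, sigmaNatι X m ≫ p = a ≫ sigmaNatι X n ≫ p := by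
    intro m n hmn
    induction n, hmn using Nat.le_induction with
    | base => exact ⟨𝟙 _, by simp⟩
    | succ n _ ih =>
      obtain ⟨a, ha⟩ := ih
      exact ⟨a ≫ t n, by rw [ha, hp n, Category.assoc]⟩
  have hδ : f ≫ δ = 0 := by
    refine eq_zero_of_comp_shift_eq_zero (oneSubShift X t)
      (eq_zero_of_comp_oneSubShift ((compactObjects K).le_shift (-1) _ hC)) _ ?_
    have h : δ ≫ (oneSubShift X t)⟦(1 : ℤ)⟧' = 0 := comp_distTriang_mor_zero₃₁ _ hT
    rw [Category.assoc, h, comp_zero]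
  obtain ⟨h, hh⟩ : ∃ h : C ⟶ sigmaNat X, f = h ≫ p := Triangle.coyoneda_exact₃ _ hT f hδ
  obtain ⟨s, b, hs⟩ := exists_eq_sum_of_mem ((compactObjects_iff C).1 hC _ _ h)
  let N := s.sup ULift.down
  have hN : ∀ j ∈ s, ∃ a : X j.down ⟶ X N, sigmaNatι X j.down ≫ p = a ≫ sigmaNatι X N ≫ p :=
    fun j hj => hle _ _ (Finset.le_sup (f := ULift.down) hj)
  choose! a ha using hN
  refine ⟨N, ∑ j ∈ s, b j ≫ a j, ?_⟩
  rw [hh]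
  conv_lhs => rw [hs]
  rw [Preadditive.sum_comp, Preadditive.sum_comp]
  refine Finset.sum_congr rfl (fun j hj => ?_)
  simp only [Category.assoc]
  exact b j ≫= ha j hj

end Telescope

/-! ### Bousfield localization at a set of compact objects -/

section Bousfield

variable {K : Type u} [Category.{v} K] [Preadditive K] [HasZeroObject K]
  [HasShift K ℤ] [∀ n : ℤ, (shiftFunctor K n).Additive] [Pretriangulated K] [HasCoproducts.{v} K]

/-- One step in the construction of the acyclization: the morphisms `G i ⟶ Γ` that vanish in `M`
are annihilated. -/
lemma exists_annihilating_step {ι : Type v} (G : ι → K) {S : ObjectProperty K}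
    (hS : IsLocalizing S) (hG : ∀ i, S (G i)) {Γ M : K} (π : Γ ⟶ M) (hΓ : S Γ) :
    ∃ (Γ' : K) (t : Γ ⟶ Γ') (π' : Γ' ⟶ M), S Γ' ∧ t ≫ π' = π ∧
      ∀ (i : ι) (f : G i ⟶ Γ), f ≫ π = 0 → f ≫ t = 0 := by
  let J := Σ i : ι, {f : G i ⟶ Γ // f ≫ π = 0}
  let e : (∐ fun j : J => G j.1) ⟶ Γ := Sigma.desc (fun j => j.2.1)
  obtain ⟨Γ', t, c, hT⟩ := distinguished_cocone_triangle e
  have he : e ≫ π = 0 := Sigma.hom_ext _ _ (fun j => by simpa [e] using j.2.2)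
  obtain ⟨π', hπ'⟩ := Triangle.yoneda_exact₂ _ hT π he
  have := hS.triangulated
  have := hS.summands
  refine ⟨Γ', t, π', ?_, hπ'.symm, fun i f hf => ?_⟩
  · exact S.ext_of_isTriangulatedClosed₃ _ hT (hS.coproduct J _ (fun j => hG j.1)) hΓ
  · have h₁ : Sigma.ι (fun j : J => G j.1) ⟨i, f, hf⟩ ≫ e = f := by simp [e]
    have h₂ : e ≫ t = 0 := comp_distTriang_mor_zero₁₂ _ hT
    rw [← h₁, Category.assoc, h₂, comp_zero]

/-- Bousfield localization at a set of compact objects: every object `M` sits in a distinguished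
triangle `Γ ⟶ M ⟶ L ⟶ Γ⟦1⟧` with `Γ` in the localizing subcategory generated by `I` and `L`
right orthogonal to `I`. Here `Γ` is the homotopy colimit of a sequence of objects over `M` that
starts with the coproduct of all morphisms from `I` to `M`. -/
lemma exists_localization_triangle [MonoidalCategory K] (I : ObjectProperty K) [I.IsStableUnderShift ℤ]
    [ObjectProperty.EssentiallySmall.{v} I] (hI : I ≤ compactObjects K) (M : K) :
    ∃ (Γ L : K) (a : Γ ⟶ M) (b : M ⟶ L) (c : L ⟶ Γ⟦(1 : ℤ)⟧),
      Triangle.mk a b c ∈ distTriang K ∧ locGen I Γ ∧ I.rightOrthogonal L := by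
  obtain ⟨Q, _, hQI, hIQ⟩ := ObjectProperty.EssentiallySmall.exists_small_le.{v} I
  let G : Shrink.{v} (Subtype Q) → K := fun i => ((equivShrink _).symm i).1
  have hG : ∀ i, I (G i) := fun i => hQI _ ((equivShrink _).symm i).2
  have hiso : ∀ D, I D → ∃ i, Nonempty (D ≅ G i) := by
    intro D hD
    obtain ⟨E, hE, ⟨e⟩⟩ := hIQ _ hD
    exact ⟨equivShrink _ ⟨E, hE⟩, ⟨e ≪≫ eqToIso (by simp [G])⟩⟩
  have hL := isLocalizing_locGen I
  have := hL.triangulated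
  have := hL.summands
  have hGL : ∀ i, locGen I (G i) := fun i => le_locGen I _ (hG i)
  -- the sequence of objects over `M` whose homotopy colimit is `Γ`
  let T := {Y : Over M // locGen I Y.left}
  have step : ∀ Y : T, ∃ Y' : T, ∃ t : Y.1.left ⟶ Y'.1.left, t ≫ Y'.1.hom = Y.1.hom ∧
      ∀ (i) (f : G i ⟶ Y.1.left), f ≫ Y.1.hom = 0 → f ≫ t = 0 := by
    intro Y
    obtain ⟨Γ', t, π', h₁, h₂, h₃⟩ := exists_annihilating_step G hL hGL Y.1.hom Y.2
    exact ⟨⟨Over.mk π', h₁⟩, t, h₂, h₃⟩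
  choose next t ht₁ ht₂ using step
  let J := Σ i, G i ⟶ M
  let Y₀ : T := ⟨Over.mk (Sigma.desc (fun j : J => j.2) : (∐ fun j : J => G j.1) ⟶ M),
    hL.coproduct J _ (fun j => hGL j.1)⟩
  let Y : ℕ → T := fun n => Nat.rec Y₀ (fun _ => next) n
  let X : ℕ → K := fun n => (Y n).1.left
  let π : ∀ n, X n ⟶ M := fun n => (Y n).1.hom
  let τ : ∀ n, X n ⟶ X (n + 1) := fun n => t (Y n)
  have hτ : ∀ n, τ n ≫ π (n + 1) = π n := fun n => ht₁ (Y n)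
  have hτ' : ∀ n (i) (f : G i ⟶ X n), f ≫ π n = 0 → f ≫ τ n = 0 := fun n => ht₂ (Y n)
  obtain ⟨Γ, p, δ, hΓ⟩ := distinguished_cocone_triangle (oneSubShift X τ)
  let q : sigmaNat X ⟶ M := Sigma.desc (fun n => π n.down)
  have hq : ∀ n, sigmaNatι X n ≫ q = π n := fun n => by simp [q, sigmaNatι]
  have hq₀ : oneSubShift X τ ≫ q = 0 := by
    refine Sigma.hom_ext _ _ (fun ⟨n⟩ => ?_)
    change sigmaNatι X n ≫ _ = sigmaNatι X n ≫ _
    rw [← Category.assoc, ι_oneSubShift, Preadditive.sub_comp, Category.assoc, hq, hq, hτ,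
      sub_self, comp_zero]
  obtain ⟨a, ha⟩ : ∃ a : Γ ⟶ M, q = p ≫ a := Triangle.yoneda_exact₂ _ hΓ q hq₀
  obtain ⟨L, b, c, hT⟩ := distinguished_cocone_triangle a
  have hXS : locGen I (sigmaNat X) := hL.coproduct _ _ (fun n => (Y n.down).2)
  refine ⟨Γ, L, a, b, c, hT, ?_, ?_⟩
  · exact (locGen I).ext_of_isTriangulatedClosed₃ _ hΓ hXS hXS
  · have hp : ∀ n, sigmaNatι X n ≫ p = τ n ≫ sigmaNatι X (n + 1) ≫ p :=
      ι_comp_eq_of_oneSubShift_comp_eq_zero (comp_distTriang_mor_zero₁₂ _ hΓ)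
    -- a morphism to `Γ` that vanishes in `M` comes from some `X n`, and dies in `X (n + 1)`
    have hinj : ∀ D, I D → ∀ x : D ⟶ Γ, x ≫ a = 0 → x = 0 := by
      intro D hD x hx
      obtain ⟨n, g, rfl⟩ := exists_factorization_hocolim (hI _ hD) hΓ x
      obtain ⟨i, ⟨e⟩⟩ := hiso D hD
      have hgπ : g ≫ π n = 0 := by
        rw [← hq n, ha]
        simpa using hx
      have hgτ : g ≫ τ n = 0 := by
        rw [← cancel_epi e.inv, ← Category.assoc, comp_zero]
        exact hτ' n i _ (by rw [Category.assoc, hgπ, comp_zero])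
      rw [hp, reassoc_of% hgτ, zero_comp]
    intro D f hD
    have hfc : f ≫ c = 0 := by
      refine eq_zero_of_comp_shift_eq_zero a (hinj _ (I.le_shift (-1) _ hD)) _ ?_
      have h : c ≫ a⟦(1 : ℤ)⟧' = 0 := comp_distTriang_mor_zero₃₁ _ hT
      rw [Category.assoc, h, comp_zero]
    obtain ⟨h, hh⟩ : ∃ h : D ⟶ M, f = h ≫ b := Triangle.coyoneda_exact₃ _ hT f hfc
    obtain ⟨i, ⟨e⟩⟩ := hiso D hD
    -- every morphism from `I` to `M` factors through the first term of the sequence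
    have h₀ : h = (e.hom ≫ Sigma.ι (fun j : J => G j.1) ⟨i, e.inv ≫ h⟩) ≫ π 0 := by
      have : Sigma.ι (fun j : J => G j.1) ⟨i, e.inv ≫ h⟩ ≫ π 0 = e.inv ≫ h := by
        simp [π, Y, Y₀]
      rw [Category.assoc, this, Iso.hom_inv_id_assoc]
    have hab : a ≫ b = 0 := comp_distTriang_mor_zero₁₂ _ hT
    have hπb : π 0 ≫ b = 0 := by
      rw [← hq 0, ha]
      simp [hab]
    rw [hh, h₀, Category.assoc, hπb, comp_zero]

end Bousfield

/-! ### Localizing subcategories and orthogonals as tensor ideals -/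

section Orthogonal

variable {K : Type u} [Category.{v} K] [Preadditive K]

lemma rightOrthogonal_of_adjunction {L R : K ⥤ K} (adj : L ⊣ R) [R.Additive]
    {I : ObjectProperty K} (hL : ∀ C, I C → I (L.obj C)) {Y : K} (hY : I.rightOrthogonal Y) :
    I.rightOrthogonal (R.obj Y) := by
  intro C f hC
  obtain ⟨g, rfl⟩ := (adj.homEquiv C Y).surjective f
  rw [hY g (hL C hC), Adjunction.homEquiv_unit, Functor.map_zero, comp_zero]

variable [HasZeroObject K] [HasShift K ℤ] [∀ n : ℤ, (shiftFunctor K n).Additive]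
  [Pretriangulated K]

lemma IsExactFunctor.additive {F : K ⥤ K} (hF : IsExactFunctor F) : F.Additive := by
  obtain ⟨_, _⟩ := hF
  infer_instance

lemma isLocalizing_leftOrthogonal [HasCoproducts.{v} K] (P : ObjectProperty K)
    [P.IsStableUnderShift ℤ] : IsLocalizing P.leftOrthogonal := by
  refine ⟨inferInstance, ⟨fun {X Y} r hY Z f hZ => ?_⟩, fun J M hM Z f hZ => ?_⟩
  · simpa using r.i ≫= hY (r.r ≫ f) hZ
  · exact Sigma.hom_ext _ _ (fun j => by rw [hM j (Sigma.ι M j ≫ f) hZ, comp_zero])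

lemma isZero_of_locGen_of_rightOrthogonal [HasCoproducts.{v} K] {I : ObjectProperty K}
    [I.IsStableUnderShift ℤ] {X : K} (h : locGen I X) (h' : I.rightOrthogonal X) : IsZero X := by
  rw [IsZero.iff_id_eq_zero]
  exact h _ (isLocalizing_leftOrthogonal I.rightOrthogonal) (fun C hC Y f hY => hY f hC) (𝟙 X) h'

lemma isThickIdeal_top [MonoidalCategory K] : IsThickIdeal (K := K) ⊤ ⊤ := by
  have : (⊤ : ObjectProperty K).IsTriangulated :=
    { exists_zero := ⟨0, isZero_zero K, trivial⟩
      toIsTriangulatedClosed₂ := .mk' (fun _ _ _ _ => trivial) }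
  exact ⟨le_rfl, this, inferInstance, fun _ _ _ _ => trivial, fun _ _ _ _ => trivial⟩

end Orthogonal

section Monoidal

variable {K : Type u} [Category.{v} K] [MonoidalCategory K] [Preadditive K] [HasZeroObject K]
  [HasShift K ℤ] [∀ n : ℤ, (shiftFunctor K n).Additive] [Pretriangulated K] [HasCoproducts.{v} K]

/-- A localizing subcategory that contains the compact objects is everything. -/
lemma IsLocalizing.prop_of_compactObjects_le (hK : IsCompactlyGenerated K) {S : ObjectProperty K}
    (hS : IsLocalizing S) (h : compactObjects K ≤ S) (M : K) : S M := by
  have := hK.essentiallySmall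
  obtain ⟨Γ, L, a, b, c, hT, hΓ, hL⟩ :=
    exists_localization_triangle (compactObjects K) le_rfl M
  have hL₀ : IsZero L := by
    by_contra hL'
    obtain ⟨C, hC, f, hf⟩ := hK.generates L hL'
    exact hf (hL f hC)
  have : IsIso a := (Triangle.isZero₃_iff_isIso₁ _ hT).1 hL₀
  have := hS.summands
  exact S.prop_of_iso (asIso a) (hΓ S hS h)

lemma IsLocalizing.tensor_of_compact_left (hK : IsCompactlyGenerated K) {S : ObjectProperty K}
    (hS : IsLocalizing S) {X : K} (h : ∀ C, compactObjects K C → S (C ⊗ X)) (A : K) :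
    S (A ⊗ X) :=
  (hS.inverseImage (hK.exact_tensorRight X)
    (hK.tensorRight_coproducts X)).prop_of_compactObjects_le hK (fun C hC => h C hC) A

lemma IsLocalizing.tensor_of_compact_right (hK : IsCompactlyGenerated K) {S : ObjectProperty K}
    (hS : IsLocalizing S) {X : K} (h : ∀ C, compactObjects K C → S (X ⊗ C)) (A : K) :
    S (X ⊗ A) :=
  (hS.inverseImage (hK.exact_tensorLeft X)
    (hK.tensorLeft_coproducts X)).prop_of_compactObjects_le hK (fun C hC => h C hC) A

/-- The localizing subcategory generated by a thick ideal of compact objects is an ideal. -/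
lemma IsThickIdeal.locGen (hK : IsCompactlyGenerated K) {I : ObjectProperty K}
    (hI : IsThickIdeal (compactObjects K) I) : IsThickIdeal ⊤ (locGen I) := by
  have hL := isLocalizing_locGen I
  refine ⟨le_top, hL.triangulated, hL.summands, fun A X _ hX => ?_, fun X A hX _ => ?_⟩
  · refine hL.tensor_of_compact_left hK (fun C hC => ?_) A
    exact hX _ (hL.inverseImage (hK.exact_tensorLeft C) (hK.tensorLeft_coproducts C))
      (fun Y hY => le_locGen I _ (hI.tensor_left C Y hC hY))
  · refine hL.tensor_of_compact_right hK (fun C hC => ?_) A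
    exact hX _ (hL.inverseImage (hK.exact_tensorRight C) (hK.tensorRight_coproducts C))
      (fun Y hY => le_locGen I _ (hI.tensor_right Y C hY hC))

lemma isLocalizing_rightOrthogonal {I : ObjectProperty K} [I.IsStableUnderShift ℤ]
    (hI : I ≤ compactObjects K) : IsLocalizing I.rightOrthogonal := by
  refine ⟨inferInstance, ⟨fun {X Y} r hY C f hC => ?_⟩, fun J M hM C f hC => ?_⟩
  · simpa using hY (f ≫ r.i) hC =≫ r.r
  · obtain ⟨s, g, rfl⟩ := exists_eq_sum_of_mem ((compactObjects_iff C).1 (hI _ hC) J M f)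
    exact Finset.sum_eq_zero (fun j _ => by rw [hM j (g j) hC, zero_comp])

lemma compactObjects_rightDual (hK : IsCompactlyGenerated K) {A A' : K} [ExactPairing A A'] :
    compactObjects K A' := by
  have := (hK.exact_tensorLeft A).additive
  exact compactObjects_of_retract (ρ_ A').symm.retract
    (compactObjects_of_adjunction (tensorLeftAdjunction A A') (hK.tensorLeft_coproducts A)
      hK.compact_unit)

lemma compactObjects_leftDual (hK : IsCompactlyGenerated K) {A A' : K} [ExactPairing A' A] :
    compactObjects K A' := by
  have := (hK.exact_tensorRight A).additive
  exact compactObjects_of_retract (λ_ A').symm.retract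
    (compactObjects_of_adjunction (tensorRightAdjunction A' A) (hK.tensorRight_coproducts A)
      hK.compact_unit)

/-- The right orthogonal of a thick ideal of compact objects is an ideal, because compact objects
are rigid. -/
lemma IsThickIdeal.rightOrthogonal (hK : IsCompactlyGenerated K) {I : ObjectProperty K}
    (hI : IsThickIdeal (compactObjects K) I) : IsThickIdeal ⊤ I.rightOrthogonal := by
  have := hI.triangulated
  have hL := isLocalizing_rightOrthogonal hI.le
  refine ⟨le_top, hL.triangulated, hL.summands, fun A X _ hX => ?_, fun X A hX _ => ?_⟩
  · refine hL.tensor_of_compact_left hK (fun C hC => ?_) A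
    obtain ⟨-, ⟨_⟩⟩ := hK.rigid C hC
    have := (hK.exact_tensorLeft C).additive
    exact rightOrthogonal_of_adjunction (tensorLeftAdjunction C Cᘁ)
      (fun D hD => hI.tensor_left _ D (compactObjects_rightDual hK (A := C)) hD) hX
  · refine hL.tensor_of_compact_right hK (fun C hC => ?_) A
    obtain ⟨⟨_⟩, -⟩ := hK.rigid C hC
    have := (hK.exact_tensorRight C).additive
    exact rightOrthogonal_of_adjunction (tensorRightAdjunction (ᘁC) C)
      (fun D hD => hI.tensor_right D _ hD (compactObjects_leftDual hK (A := C))) hX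

lemma isThickIdeal_compactObjects (hK : IsCompactlyGenerated K) :
    IsThickIdeal (compactObjects K) (compactObjects K) :=
  ⟨le_rfl, inferInstance, inferInstance, fun M N hM hN => hK.compact_tensor M N hM hN,
    fun M N hM hN => hK.compact_tensor M N hM hN⟩

end Monoidal

/-! ### Supports and thick ideals -/

section Support

variable {K : Type u} [Category.{v} K] {X : Type w} {σ : K → Set X}

lemma mem_Phi {S : ObjectProperty K} {x : X} : x ∈ Phi σ S ↔ ∃ M, S M ∧ x ∈ σ M := by
  simp [Phi]

lemma subset_Phi {S : ObjectProperty K} {M : K} (hM : S M) : σ M ⊆ Phi σ S :=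
  fun _ hx => mem_Phi.2 ⟨M, hM, hx⟩

lemma Phi_subset_iff {S : ObjectProperty K} {W : Set X} :
    Phi σ S ⊆ W ↔ ∀ M, S M → σ M ⊆ W := by
  simp [Phi]

lemma Phi_mono {S S' : ObjectProperty K} (h : S ≤ S') : Phi σ S ⊆ Phi σ S' :=
  Phi_subset_iff.2 (fun M hM => subset_Phi (h M hM))

variable [MonoidalCategory K] [Preadditive K] [HasZeroObject K]
  [HasShift K ℤ] [∀ n : ℤ, (shiftFunctor K n).Additive] [Pretriangulated K]

lemma mem_principal {A : ObjectProperty K} (M : K) : principal A M M := fun _ _ h => h M rfl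

lemma isThickIdeal_principal {A : ObjectProperty K} (hA : IsThickIdeal A A) {M : K} (hM : A M) :
    IsThickIdeal A (principal A M) :=
  isThickIdeal_idealGen ⟨A, hA, by rintro _ rfl; exact hM⟩

lemma principal_le {A I : ObjectProperty K} (hI : IsThickIdeal A I) {M : K} (hM : I M) :
    principal A M ≤ I := fun _ hN => hN I hI (by rintro _ rfl; exact hM)

lemma IsThickIdeal.Phi_eq_iUnion {A I : ObjectProperty K} (hI : IsThickIdeal A I) :
    Phi σ I = ⋃ (M : K) (_ : I M), Phi σ (principal A M) := by
  refine subset_antisymm (Phi_subset_iff.2 fun M hM => ?_) ?_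
  · exact (subset_Phi (mem_principal M)).trans
      (Set.subset_iUnion₂ (s := fun (M : K) (_ : I M) => Phi σ (principal A M)) M hM)
  · exact Set.iUnion₂_subset fun M hM => Phi_mono (principal_le hI hM)

lemma IsMonoidalTriangulated.isTriangulated_inverseImage (hK : IsMonoidalTriangulated K)
    {S : ObjectProperty K} (hS : S.IsTriangulated) (hr : S.IsStableUnderRetracts) (B C : K) :
    ObjectProperty.IsTriangulated (fun M => S ((B ⊗ M) ⊗ C)) := by
  obtain ⟨_, _⟩ := hK.exact_tensorLeft B
  obtain ⟨_, _⟩ := hK.exact_tensorRight C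
  exact inferInstanceAs ((S.inverseImage (tensorRight C)).inverseImage (tensorLeft B)).IsTriangulated

variable [HasCoproducts.{v} K]

namespace IsExtendedWeakSupportDatum

variable (hσ : IsExtendedWeakSupportDatum σ)
include hσ

lemma subset_of_iso {M N : K} (e : M ≅ N) : σ M ⊆ σ N := by
  have hT : Triangle.mk e.hom (0 : N ⟶ 0) 0 ∈ distTriang K :=
    (Triangle.distinguished_iff_of_isZero₃ _ (isZero_zero K)).2 (inferInstanceAs (IsIso e.hom))
  have : σ M ⊆ σ N ∪ σ 0 := hσ.triangle _ hT
  rwa [hσ.zero, Set.union_empty] at this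

lemma eq_of_iso {M N : K} (e : M ≅ N) : σ M = σ N :=
  (hσ.subset_of_iso e).antisymm (hσ.subset_of_iso e.symm)

lemma eq_empty_of_isZero {M : K} (hM : IsZero M) : σ M = ∅ := by
  rw [hσ.eq_of_iso hM.isoZero, hσ.zero]

lemma shift_int (M : K) (n : ℤ) : σ (M⟦n⟧) = σ M := by
  induction n using Int.induction_on with
  | zero => exact hσ.eq_of_iso ((shiftFunctorZero K ℤ).app M)
  | succ n ih =>
    rw [← ih, ← hσ.shift (M⟦(n : ℤ)⟧)]
    exact hσ.eq_of_iso ((shiftFunctorAdd' K (n : ℤ) 1 _ rfl).app M)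
  | pred n ih =>
    rw [← ih, ← hσ.shift (M⟦(-n - 1 : ℤ)⟧)]
    exact hσ.eq_of_iso ((shiftFunctorAdd' K (-n - 1 : ℤ) 1 (-n) (by ring)).symm.app M)

lemma biprod_eq (M N : K) : σ (M ⊞ N) = σ M ∪ σ N := by
  let F : ULift.{v} Bool → K := fun b => Bool.rec N M b.down
  let e : ∐ F ≅ M ⊞ N :=
    { hom := Sigma.desc (fun b => match b with
        | ⟨true⟩ => biprod.inl
        | ⟨false⟩ => biprod.inr)
      inv := biprod.desc (Sigma.ι F ⟨true⟩) (Sigma.ι F ⟨false⟩)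
      hom_inv_id := Sigma.hom_ext _ _ (by rintro ⟨_ | _⟩ <;> simp)
      inv_hom_id := by apply biprod.hom_ext' <;> simp <;> rfl }
  rw [← hσ.eq_of_iso e, hσ.coproduct]
  ext x
  simp only [Set.mem_iUnion, ULift.exists, Bool.exists_bool, Set.mem_union]
  exact or_comm

/-- A retract is a direct summand in a triangulated category. -/
lemma subset_of_retract {M N : K} (r : Retract M N) : σ M ⊆ σ N := by
  obtain ⟨Z, g, h, hT⟩ := distinguished_cocone_triangle r.i
  have hh : h = 0 := Triangle.mor₃_eq_zero_of_mono₁ _ hT (inferInstanceAs (Mono r.i))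
  obtain ⟨e, -, -⟩ := exists_iso_binaryBiproduct_of_distTriang _ hT hh
  have e' : N ≅ M ⊞ Z := e
  rw [hσ.eq_of_iso e', hσ.biprod_eq]
  exact Set.subset_union_left

/-- The objects supported in a fixed subset form a localizing subcategory. -/
lemma isLocalizing_supported (W : Set X) : IsLocalizing (fun M : K => σ M ⊆ W) := by
  have hr : ObjectProperty.IsStableUnderRetracts (fun M : K => σ M ⊆ W) :=
    ⟨fun r hN => (hσ.subset_of_retract r).trans hN⟩
  refine ⟨?_, hr, fun J M hM => ?_⟩
  · have hz : ObjectProperty.ContainsZero (fun M : K => σ M ⊆ W) :=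
      ⟨0, isZero_zero K, by simp [hσ.zero]⟩
    have hs : ObjectProperty.IsStableUnderShift (fun M : K => σ M ⊆ W) ℤ :=
      ⟨fun n => ⟨fun M hM => (hσ.shift_int M n).subset.trans hM⟩⟩
    have ht : ObjectProperty.IsTriangulatedClosed₂ (fun M : K => σ M ⊆ W) := by
      refine .mk' (fun T hT h₁ h₃ => ?_)
      refine (hσ.triangle _ (rot_of_distTriang _ hT)).trans (Set.union_subset h₃ ?_)
      exact (hσ.shift T.obj₁).subset.trans h₁
    exact { }
  · rw [hσ.coproduct]
    exact Set.iUnion_subset hM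

end IsExtendedWeakSupportDatum

/-- The objects `M` of `A` such that all the objects `B ⊗ M ⊗ C`, with `B` and `C` in `A`, are
supported in `W`. -/
def supportedIdeal (σ : K → Set X) (A : ObjectProperty K) (W : Set X) : ObjectProperty K :=
  fun M => A M ∧ ∀ B C, A B → A C → σ ((B ⊗ M) ⊗ C) ⊆ W

variable (hσ : IsExtendedWeakSupportDatum σ)
include hσ

lemma isThickIdeal_supportedIdeal (hK : IsMonoidalTriangulated K) {A : ObjectProperty K}
    (hA : IsThickIdeal A A) (W : Set X) : IsThickIdeal A (supportedIdeal σ A W) := by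
  have hS := hσ.isLocalizing_supported W
  have hT := fun B C => hK.isTriangulated_inverseImage hS.triangulated hS.summands B C
  have := hA.triangulated
  have := hA.summands
  have hr : (supportedIdeal σ A W).IsStableUnderRetracts := by
    refine ⟨fun {M N} r hN => ⟨hA.summands.of_retract r hN.1, fun B C hB hC => ?_⟩⟩
    exact hS.summands.of_retract ((r.map (tensorLeft B)).map (tensorRight C)) (hN.2 B C hB hC)
  refine ⟨fun M hM => hM.1, ?_, hr, fun M N hM hN => ⟨hA.tensor_left M N hM hN.1, ?_⟩,
    fun M N hM hN => ⟨hA.tensor_right M N hM.1 hN, ?_⟩⟩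
  · have hz : (supportedIdeal σ A W).ContainsZero := by
      obtain ⟨Z, hZ, hAZ⟩ := hA.triangulated.toContainsZero.exists_zero
      refine ⟨Z, hZ, hAZ, fun B C _ _ => ?_⟩
      have := (hK.exact_tensorLeft B).additive
      have := (hK.exact_tensorRight C).additive
      rw [hσ.eq_empty_of_isZero (M := (B ⊗ Z) ⊗ C)
        ((tensorRight C).map_isZero ((tensorLeft B).map_isZero hZ))]
      exact Set.empty_subset _
    have hs : (supportedIdeal σ A W).IsStableUnderShift ℤ :=
      ⟨fun n => ⟨fun M hM => ⟨A.le_shift n _ hM.1, fun B C hB hC =>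
        (hT B C).toIsStableUnderShift.isStableUnderShiftBy n |>.le_shift _ (hM.2 B C hB hC)⟩⟩⟩
    have ht : (supportedIdeal σ A W).IsTriangulatedClosed₂ := by
      refine .mk' (fun T hT' h₁ h₃ => ⟨A.ext_of_isTriangulatedClosed₂ T hT' h₁.1 h₃.1,
        fun B C hB hC => ?_⟩)
      obtain ⟨Y, hY, ⟨e⟩⟩ := (hT B C).toIsTriangulatedClosed₂.ext₂' T hT'
        (h₁.2 B C hB hC) (h₃.2 B C hB hC)
      exact (hσ.eq_of_iso (((tensorRight C).mapIso ((tensorLeft B).mapIso e)))).subset.trans hY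
    exact { }
  · intro B C hB hC
    have := hN.2 (B ⊗ M) C (hA.tensor_left B M hB hM) hC
    rwa [hσ.eq_of_iso (whiskerRightIso (α_ B M N) C)] at this
  · intro B C hB hC
    have := hM.2 B (N ⊗ C) hB (hA.tensor_left N C hN hC)
    rwa [hσ.eq_of_iso ((α_ (B ⊗ M) N C).symm ≪≫ whiskerRightIso (α_ B M N) C)] at this

end Support

/-! ### Supports of thick ideals of compact objects -/

section CompactSupport

variable {K : Type u} [Category.{v} K] [MonoidalCategory K] [Preadditive K] [HasZeroObject K]
  [HasShift K ℤ] [∀ n : ℤ, (shiftFunctor K n).Additive] [Pretriangulated K]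
  {X : Type w} {σ : K → Set X}

lemma IsThickIdeal.tensorCollection_le_right {A I J : ObjectProperty K} (hI : IsThickIdeal A I)
    (hJ : IsThickIdeal A J) : tensorCollection I J ≤ J := by
  rintro L ⟨M, N, hM, hN, ⟨e⟩⟩
  exact hJ.summands.of_retract e.retract (hJ.tensor_left M N (hI.le _ hM) hN)

lemma IsThickIdeal.le_Theta_Phi {I : ObjectProperty K}
    (hI : IsThickIdeal (compactObjects K) I) : I ≤ Theta σ (Phi σ I) :=
  fun M hM => ⟨hI.le M hM, Phi_mono (principal_le hI hM)⟩

lemma Theta_mono {W W' : Set X} (h : W ⊆ W') : Theta σ W ≤ Theta σ W' :=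
  fun _ hM => ⟨hM.1, hM.2.trans h⟩

lemma Phi_Theta_subset (W : Set X) : Phi σ (Theta σ W) ⊆ W :=
  Phi_subset_iff.2 fun M hM => (subset_Phi (mem_principal M)).trans hM.2

lemma isSpecializationClosed_Phi [TopologicalSpace X] (hclosed : ∀ C : K, compactObjects K C →
      IsClosed (Phi σ (principal (compactObjects K) C))) {I : ObjectProperty K}
    (hI : IsThickIdeal (compactObjects K) I) : IsSpecializationClosed (Phi σ I) := by
  refine ⟨{Z | ∃ M, I M ∧ Phi σ (principal (compactObjects K) M) = Z}, ?_, ?_⟩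
  · rintro _ ⟨M, hM, rfl⟩
    exact hclosed M (hI.le M hM)
  · rw [hI.Phi_eq_iUnion]
    ext x
    simp

variable [HasCoproducts.{v} K]
  (hK : IsCompactlyGenerated K) (hσ : IsExtendedWeakSupportDatum σ)

include hσ in
lemma subset_of_supportedIdeal {A : ObjectProperty K} (h1 : A (𝟙_ K)) {W : Set X} {M : K}
    (hM : supportedIdeal σ A W M) : σ M ⊆ W :=
  (hσ.subset_of_iso ((ρ_ M).symm ≪≫ whiskerRightIso (λ_ M).symm (𝟙_ K))).trans
    (hM.2 (𝟙_ K) (𝟙_ K) h1 h1)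

include hσ in
lemma supportedIdeal_iff (hK : IsMonoidalTriangulated K) {A : ObjectProperty K}
    (hA : IsThickIdeal A A) (h1 : A (𝟙_ K)) {W : Set X} {M : K} :
    supportedIdeal σ A W M ↔ A M ∧ Phi σ (principal A M) ⊆ W := by
  refine ⟨fun hM => ⟨hM.1, Phi_subset_iff.2 fun N hN => ?_⟩,
    fun hM => ⟨hM.1, fun B C hB hC => ?_⟩⟩
  · exact subset_of_supportedIdeal hσ h1
      (principal_le (isThickIdeal_supportedIdeal hσ hK hA W) hM N hN)
  · have hP := isThickIdeal_principal hA hM.1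
    exact (subset_Phi (hP.tensor_right _ C (hP.tensor_left B M hB (mem_principal M)) hC)).trans hM.2

include hK hσ

lemma Theta_eq (W : Set X) : Theta σ W = supportedIdeal σ (compactObjects K) W := by
  ext M
  exact (supportedIdeal_iff hσ hK.toIsMonoidalTriangulated (isThickIdeal_compactObjects hK)
    hK.compact_unit).symm

lemma isThickIdeal_Theta (W : Set X) : IsThickIdeal (compactObjects K) (Theta σ W) := by
  rw [Theta_eq hK hσ]
  exact isThickIdeal_supportedIdeal hσ hK.toIsMonoidalTriangulated
    (isThickIdeal_compactObjects hK) W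

/-- In `(B ⊗ M) ⊗ C` the objects `B` and `C` may be taken compact when testing the support,
since the compact objects generate `K` as a localizing subcategory. -/
lemma supportedIdeal_top_of_Theta {W : Set X} {M : K} (hM : Theta σ W M) :
    supportedIdeal σ ⊤ W M := by
  rw [Theta_eq hK hσ] at hM
  have hS := hσ.isLocalizing_supported W
  refine ⟨trivial, fun B C _ _ => ?_⟩
  refine hS.tensor_of_compact_right hK (fun C hC => ?_) C
  exact (hS.inverseImage (hK.exact_tensorRight C)
    (hK.tensorRight_coproducts C)).tensor_of_compact_left hK (fun B hB => hM.2 B C hB hC) B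

lemma locGen_le_supportedIdeal {I : ObjectProperty K} {W : Set X} (hI : I ≤ Theta σ W) :
    locGen I ≤ supportedIdeal σ ⊤ W := by
  have hS := hσ.isLocalizing_supported W
  refine fun N hN => ⟨trivial, fun B C _ _ => ?_⟩
  exact hN _ ((hS.inverseImage (hK.exact_tensorRight C) (hK.tensorRight_coproducts C)).inverseImage
    (hK.exact_tensorLeft B) (hK.tensorLeft_coproducts B))
    (fun M hM => (supportedIdeal_top_of_Theta hK hσ (hI M hM)).2 B C trivial trivial)

lemma Phi_locGen {I : ObjectProperty K} (hI : IsThickIdeal (compactObjects K) I) :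
    Phi σ (locGen I) = Phi σ I := by
  refine subset_antisymm (Phi_subset_iff.2 fun M hM => ?_) (Phi_mono (le_locGen I))
  exact subset_of_supportedIdeal hσ trivial
    (locGen_le_supportedIdeal hK hσ hI.le_Theta_Phi M hM)

/-- The tensor axiom for thick ideals of compact objects: it is deduced from the axiom for the
localizing ideals that they generate. -/
lemma Phi_tensorCollection {I J : ObjectProperty K} (hI : IsThickIdeal (compactObjects K) I)
    (hJ : IsThickIdeal (compactObjects K) J) :
    Phi σ (tensorCollection I J) = Phi σ I ∩ Phi σ J := by
  refine subset_antisymm (Set.subset_inter (Phi_mono (hI.tensorCollection_le hJ))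
    (Phi_mono (hI.tensorCollection_le_right hJ))) ?_
  rw [← Phi_locGen hK hσ hI, ← Phi_locGen hK hσ hJ,
    ← hσ.tensor _ _ (hI.locGen hK) (hJ.locGen hK), Phi_subset_iff]
  rintro L ⟨M, N, hM, hN, ⟨e⟩⟩
  rw [hσ.eq_of_iso e]
  have hS := hσ.isLocalizing_supported (Phi σ (tensorCollection I J))
  refine hM _ (hS.inverseImage (hK.exact_tensorRight N) (hK.tensorRight_coproducts N))
    (fun C hC => ?_)
  refine hN _ (hS.inverseImage (hK.exact_tensorLeft C) (hK.tensorLeft_coproducts C))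
    (fun D hD => ?_)
  exact subset_Phi (⟨C, D, hC, hD, ⟨Iso.refl _⟩⟩ : tensorCollection I J (C ⊗ D))

lemma Phi_mul {I J : ObjectProperty K} (hI : IsThickIdeal (compactObjects K) I)
    (hJ : IsThickIdeal (compactObjects K) J) :
    Phi σ (idealGen (compactObjects K) (tensorCollection I J)) = Phi σ I ∩ Phi σ J := by
  refine subset_antisymm (Set.subset_inter (Phi_mono fun M hM => ?_) (Phi_mono fun M hM => ?_)) ?_
  · exact hM I hI (hI.tensorCollection_le hJ)
  · exact hM J hJ (hI.tensorCollection_le_right hJ)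
  · rw [← Phi_tensorCollection hK hσ hI hJ]
    exact Phi_mono (fun M hM _ _ h => h M hM)

lemma isPrimeIdeal_fIdeal (x : X) : IsPrimeIdeal (compactObjects K) (fIdeal σ x) := by
  have hf : fIdeal σ x = Theta σ {x}ᶜ := by
    ext M
    exact and_congr_right fun _ => Set.subset_compl_singleton_iff.symm
  refine ⟨hf ▸ isThickIdeal_Theta hK hσ _, fun h => ?_, fun I J hI hJ hIJ => ?_⟩
  · have h1 : fIdeal σ x (𝟙_ K) := h ▸ hK.compact_unit
    exact h1.2 (subset_Phi (mem_principal _) (by rw [hσ.unit]; trivial))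
  · by_contra hcon
    obtain ⟨hcon₁, hcon₂⟩ := not_or.1 hcon
    have key : ∀ I : ObjectProperty K, IsThickIdeal (compactObjects K) I → ¬ I ≤ fIdeal σ x →
        x ∈ Phi σ I := by
      intro I hI h
      by_contra hx
      exact h (fun M hM => ⟨hI.le M hM, fun hx' => hx (Phi_mono (principal_le hI hM) hx')⟩)
    have hx : x ∈ Phi σ (tensorCollection I J) := by
      rw [Phi_tensorCollection hK hσ hI hJ]
      exact ⟨key I hI hcon₁, key J hJ hcon₂⟩
    obtain ⟨M, hM, hxM⟩ := mem_Phi.1 hx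
    exact (hIJ M hM).2 (subset_Phi (mem_principal M) hxM)

/-- If `σ` has the faithfulness property, a thick ideal of compact objects is determined by its
support. -/
lemma Theta_Phi_of_faithful (hf : Faithful σ) {I : ObjectProperty K}
    (hI : IsThickIdeal (compactObjects K) I) : Theta σ (Phi σ I) = I := by
  refine le_antisymm (fun M hM => ?_) hI.le_Theta_Phi
  have := hK.isTriangulated
  have := hI.triangulated
  have := hI.summands
  have := hK.essentiallySmall
  have : ObjectProperty.EssentiallySmall.{v} I := .of_le hI.le
  obtain ⟨Γ, L, a, b, c, hT, hΓ, hL⟩ := exists_localization_triangle I hI.le M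
  have hP := isThickIdeal_principal isThickIdeal_top (M := L) trivial
  have hR := hI.rightOrthogonal hK
  have hG := hI.locGen hK
  -- `Φ(⟪L⟫)` is contained in `Φ(I)`, since `M` and `Γ` are supported there
  have h₁ : Phi σ (principal ⊤ L) ⊆ Phi σ (locGen I) := by
    rw [Phi_locGen hK hσ hI]
    have hS := isThickIdeal_supportedIdeal hσ hK.toIsMonoidalTriangulated isThickIdeal_top
      (Phi σ I)
    have := hS.triangulated
    have := hS.summands
    have hSL : supportedIdeal σ ⊤ (Phi σ I) L :=
      (supportedIdeal σ ⊤ (Phi σ I)).ext_of_isTriangulatedClosed₃ _ hT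
        (locGen_le_supportedIdeal hK hσ hI.le_Theta_Phi Γ hΓ) (supportedIdeal_top_of_Theta hK hσ hM)
    exact ((supportedIdeal_iff hσ hK.toIsMonoidalTriangulated isThickIdeal_top trivial).1 hSL).2
  -- `Φ(⟪L⟫)` is disjoint from `Φ(I)`, since `⟪L⟫ ⊗ Loc(I)` vanishes
  have h₂ : Phi σ (principal ⊤ L) ∩ Phi σ (locGen I) = ∅ := by
    rw [← hσ.tensor _ _ hP hG, ← Set.subset_empty_iff, Phi_subset_iff]
    rintro N ⟨Y, Z, hY, hZ, ⟨e⟩⟩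
    have hY' : I.rightOrthogonal Y := principal_le hR hL Y hY
    have h₀ : IsZero (Y ⊗ Z) := isZero_of_locGen_of_rightOrthogonal
      (hG.tensor_left Y Z trivial hZ) (hR.tensor_right Y Z hY' trivial)
    exact (hσ.eq_empty_of_isZero (h₀.of_iso e)).subset
  have hL₀ : IsZero L := (hf L).1 (by rwa [Set.inter_eq_left.2 h₁] at h₂)
  have : IsIso a := (Triangle.isZero₃_iff_isIso₁ _ hT).1 hL₀
  have := hG.summands
  exact prop_of_compact_of_locGen hI.le hM.1 ((locGen I).prop_of_iso (asIso a) hΓ)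

variable [TopologicalSpace X]

lemma Phi_Theta_of_realizing (hr : Realizing σ) {W : Set X} (hW : IsSpecializationClosed W) :
    Phi σ (Theta σ W) = W := by
  refine subset_antisymm (Phi_Theta_subset W) ?_
  obtain ⟨S, hS, rfl⟩ := hW
  refine Set.sUnion_subset fun Z hZ => ?_
  obtain ⟨M, hM, hMZ⟩ := hr Z (hS Z hZ)
  have hMT : Theta σ (⋃₀ S) M := ⟨hM, hMZ.subset.trans (Set.subset_sUnion_of_mem hZ)⟩
  rw [← hMZ]
  exact Phi_mono (principal_le (isThickIdeal_Theta hK hσ _) hMT)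

end CompactSupport

/-! ### Specialization-closed subsets of Zariski spaces -/

section Topology

variable {X : Type w} [TopologicalSpace X]

lemma IsZariskiSpace.t0Space (hX : IsZariskiSpace X) : T0Space X := by
  refine ⟨fun x y h => ?_⟩
  have hxy := inseparable_iff_closure_eq.1 h
  obtain ⟨z, -, hz⟩ := hX.existsUnique_genericPoint (closure {x})
    isIrreducible_singleton.closure isClosed_closure
  exact (hz x rfl).trans (hz y hxy.symm).symm

lemma specializationInterior_subset (S : Set X) : specializationInterior S ⊆ S :=
  Set.sUnion_subset fun _ hZ => hZ.2

lemma IsSpecializationClosed.subset_specializationInterior {W S : Set X}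
    (hW : IsSpecializationClosed W) (h : W ⊆ S) : W ⊆ specializationInterior S := by
  obtain ⟨T, hT, rfl⟩ := hW
  exact Set.sUnion_subset fun Z hZ => Set.subset_sUnion_of_mem
    (⟨hT Z hZ, (Set.subset_sUnion_of_mem hZ).trans h⟩ : IsClosed Z ∧ Z ⊆ S)

/-- In a Zariski space, the meet-prime specialization-closed sets are the sets
`(X ∖ {x})_sp`: take for `x` the generic point of a minimal closed set not contained in `W`. -/
lemma IsZariskiSpace.exists_eq_specializationInterior (hX : IsZariskiSpace X) {W : Set X}
    (hW : IsSpecializationClosed W) (hne : W ≠ Set.univ)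
    (hprime : ∀ Z Z' : Set X, IsClosed Z → IsClosed Z' → Z ∩ Z' ⊆ W → Z ⊆ W ∨ Z' ⊆ W) :
    ∃ x : X, W = specializationInterior ({x}ᶜ : Set X) := by
  have := hX.noetherian
  obtain ⟨Z, hZ, hmin⟩ := wellFounded_lt.has_min
    {Z : TopologicalSpace.Closeds X | ¬ (Z : Set X) ⊆ W}
    ⟨⊤, fun h => hne (Set.univ_subset_iff.1 h)⟩
  have hmin' : ∀ Z' : Set X, IsClosed Z' → ¬ (Z : Set X) ∩ Z' ⊆ W → (Z : Set X) ⊆ Z' := by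
    intro Z' hZ' h
    by_contra hcon
    refine hmin ⟨Z ∩ Z', Z.isClosed.inter hZ'⟩ h ?_
    exact SetLike.coe_ssubset_coe.1
      ⟨Set.inter_subset_left, fun h' => hcon (h'.trans Set.inter_subset_right)⟩
  have hirr : IsIrreducible (Z : Set X) := by
    refine ⟨Set.nonempty_iff_ne_empty.2 fun h => hZ (by simp [h]),
      isPreirreducible_iff_isClosed_union_isClosed.2 fun Z₁ Z₂ h₁ h₂ h => ?_⟩
    by_contra hcon
    obtain ⟨hcon₁, hcon₂⟩ := not_or.1 hcon
    refine hZ fun z hz => ?_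
    rcases h hz with hz' | hz'
    · exact not_not.1 (mt (hmin' Z₁ h₁) hcon₁) ⟨hz, hz'⟩
    · exact not_not.1 (mt (hmin' Z₂ h₂) hcon₂) ⟨hz, hz'⟩
  obtain ⟨x, hx, -⟩ := hX.existsUnique_genericPoint Z hirr Z.isClosed
  have hxZ : closure {x} = (Z : Set X) := hx
  refine ⟨x, subset_antisymm (hW.subset_specializationInterior ?_) ?_⟩
  · rw [Set.subset_compl_singleton_iff]
    obtain ⟨S, hS, rfl⟩ := hW
    rintro ⟨Z', hZ', hxZ'⟩
    refine hZ (hxZ ▸ (closure_minimal ?_ (hS Z' hZ')).trans (Set.subset_sUnion_of_mem hZ'))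
    exact Set.singleton_subset_iff.2 hxZ'
  · refine Set.sUnion_subset fun Z' ⟨hZ', hxZ'⟩ => ?_
    by_contra hcon
    have h : ¬ (Z : Set X) ∩ Z' ⊆ W := fun h =>
      (hprime Z Z' Z.isClosed hZ' h).elim hZ hcon
    exact Set.subset_compl_singleton_iff.1 hxZ'
      (hmin' Z' hZ' h (hxZ ▸ subset_closure (Set.mem_singleton x)))

end Topology

/-! ### Maps to the spectrum -/

section Spectrum

variable {K : Type u} [Category.{v} K] [MonoidalCategory K] [Preadditive K] [HasZeroObject K]
  [HasShift K ℤ] [∀ n : ℤ, (shiftFunctor K n).Additive] [Pretriangulated K]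

lemma isClosed_V {A S : ObjectProperty K} (hS : S ≤ A) : IsClosed (V A S) :=
  ⟨TopologicalSpace.isOpen_generateFrom_of_mem ⟨S, hS, rfl⟩⟩

lemma mem_V_singleton {A : ObjectProperty K} {M : K} {P : Spc A} :
    P ∈ V A (fun N => N = M) ↔ ¬ P.1 M :=
  ⟨fun h => h M rfl, by rintro h _ rfl; exact h⟩

/-- A map to the spectrum is continuous if the preimages of the sets `V(M)` are closed. -/
lemma continuous_Spc {X : Type w} [TopologicalSpace X] {A : ObjectProperty K} {f : X → Spc A}
    (h : ∀ M, A M → IsClosed (f ⁻¹' V A (fun N => N = M))) : Continuous f := by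
  refine continuous_generateFrom_iff.2 ?_
  rintro _ ⟨S, hS, rfl⟩
  have : f ⁻¹' V A S = ⋂ (M : K) (_ : S M), f ⁻¹' V A (fun N => N = M) := by
    ext x
    simp only [Set.mem_iInter, Set.mem_preimage, mem_V_singleton]
    rfl
  rw [Set.preimage_compl, isOpen_compl_iff, this]
  exact isClosed_iInter fun M => isClosed_iInter fun hM => h M (hS M hM)

end Spectrum

end MonTri

theorem theoremC {K : Type u} [Category.{v} K] [MonoidalCategory K] [Preadditive K]
    [HasZeroObject K] [HasShift K ℤ] [∀ n : ℤ, (shiftFunctor K n).Additive] [Pretriangulated K]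
    [HasCoproducts.{v} K] (hK : MonTri.IsCompactlyGenerated K)
    {X : Type w} [TopologicalSpace X] (hX : MonTri.IsZariskiSpace X)
    (σ : K → Set X) (hσ : MonTri.IsExtendedWeakSupportDatum σ)
    (hclosed : ∀ C : K, MonTri.compactObjects K C →
      IsClosed (MonTri.Phi σ (MonTri.principal (MonTri.compactObjects K) C))) :
    -- the maps `Φ_σ`, `Θ_σ` and `f_σ` between the sets they are claimed to relate
    ∃ (Φ : MonTri.ThickId (MonTri.compactObjects K) → MonTri.SpClosed X)
      (Θ : MonTri.SpClosed X → MonTri.ThickId (MonTri.compactObjects K))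
      (f : X → MonTri.Spc (MonTri.compactObjects K)),
      (∀ I, (Φ I).1 = MonTri.Phi σ I.1) ∧
      (∀ W, (Θ W).1 = MonTri.Theta σ W.1) ∧
      (∀ x, (f x).1 = MonTri.fIdeal σ x) ∧
      -- `f_σ` is the universal map
      Continuous f ∧
      (∀ M : K, MonTri.compactObjects K M →
        f ⁻¹' (MonTri.V (MonTri.compactObjects K) (fun N => N = M)) =
          MonTri.Phi σ (MonTri.principal (MonTri.compactObjects K) M)) ∧
      (∀ g : X → MonTri.Spc (MonTri.compactObjects K), Continuous g →
        (∀ M : K, MonTri.compactObjects K M →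
          g ⁻¹' (MonTri.V (MonTri.compactObjects K) (fun N => N = M)) =
            MonTri.Phi σ (MonTri.principal (MonTri.compactObjects K) M)) → g = f) ∧
      -- (a)
      (MonTri.Faithful σ → Θ ∘ Φ = id) ∧
      -- (b)
      (MonTri.Realizing σ → Φ ∘ Θ = id ∧ Function.Injective f) ∧
      -- (c)
      (MonTri.Faithful σ → MonTri.Realizing σ →
        -- (i) mutually inverse isomorphisms of ordered monoids
        (∃ e : MonTri.ThickId (MonTri.compactObjects K) ≃*o MonTri.SpClosed X,
          (∀ I, e I = Φ I) ∧ (∀ W, e.symm W = Θ W)) ∧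
        (∀ I J L : MonTri.ThickId (MonTri.compactObjects K), I * J * L = I * (J * L)) ∧
        (∀ I J L : MonTri.ThickId (MonTri.compactObjects K),
          I ≤ J → I * L ≤ J * L ∧ L * I ≤ L * J) ∧
        (∃ E : MonTri.ThickId (MonTri.compactObjects K), E.1 = MonTri.compactObjects K ∧
          (∀ I, E * I = I ∧ I * E = I) ∧ (Φ E).1 = Set.univ) ∧
        -- (ii)
        (∀ P : MonTri.Spc (MonTri.compactObjects K), ∃ x : X,
          MonTri.Phi σ P.1 = MonTri.specializationInterior ({x}ᶜ : Set X)) ∧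
        -- (iii)
        IsHomeomorph f) := by
  have hA := MonTri.isThickIdeal_compactObjects hK
  let Φ : MonTri.ThickId (MonTri.compactObjects K) → MonTri.SpClosed X :=
    fun I => ⟨MonTri.Phi σ I.1, MonTri.isSpecializationClosed_Phi hclosed I.2⟩
  let Θ : MonTri.SpClosed X → MonTri.ThickId (MonTri.compactObjects K) :=
    fun W => ⟨MonTri.Theta σ W.1, MonTri.isThickIdeal_Theta hK hσ W.1⟩
  let f : X → MonTri.Spc (MonTri.compactObjects K) :=
    fun x => ⟨MonTri.fIdeal σ x, MonTri.isPrimeIdeal_fIdeal hK hσ x⟩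
  have hfV : ∀ M : K, MonTri.compactObjects K M →
      f ⁻¹' (MonTri.V (MonTri.compactObjects K) (fun N => N = M)) =
        MonTri.Phi σ (MonTri.principal (MonTri.compactObjects K) M) := by
    intro M hM
    ext x
    rw [Set.mem_preimage, MonTri.mem_V_singleton]
    exact ⟨fun h => by_contra fun hx => h ⟨hM, hx⟩, fun hx h => h.2 hx⟩
  have hcont : Continuous f :=
    MonTri.continuous_Spc fun M hM => hfV M hM ▸ hclosed M hM
  have hΘΦ : MonTri.Faithful σ → ∀ I, Θ (Φ I) = I := fun hf I =>
    Subtype.ext (MonTri.Theta_Phi_of_faithful hK hσ hf I.2)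
  have hΦΘ : MonTri.Realizing σ → ∀ W, Φ (Θ W) = W := fun hr W =>
    Subtype.ext (MonTri.Phi_Theta_of_realizing hK hσ hr W.2)
  have hΦmul : ∀ I J, Φ (I * J) = Φ I * Φ J := fun I J =>
    Subtype.ext (MonTri.Phi_mul hK hσ I.2 J.2)
  have hΦmono : ∀ {I J}, I ≤ J → Φ I ≤ Φ J := fun h => MonTri.Phi_mono h
  have hΘmono : ∀ {W W'}, W ≤ W' → Θ W ≤ Θ W' := fun h => MonTri.Theta_mono h
  have hinj : MonTri.Realizing σ → Function.Injective f := by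
    intro hr x y hxy
    have := hX.t0Space
    have key : ∀ Z : Set X, IsClosed Z → (x ∈ Z ↔ y ∈ Z) := by
      intro Z hZ
      obtain ⟨M, hM, rfl⟩ := hr Z hZ
      rw [← hfV M hM, Set.mem_preimage, Set.mem_preimage, hxy]
    exact (inseparable_iff_forall_isClosed.2 key).eq
  refine ⟨Φ, Θ, f, fun _ => rfl, fun _ => rfl, fun _ => rfl, hcont, hfV, ?_,
    fun hf => funext (hΘΦ hf), fun hr => ⟨funext (hΦΘ hr), hinj hr⟩, fun hf hr => ?_⟩
  -- a map with the prescribed preimages of the sets `V(M)` has the prescribed members of `g x`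
  · intro g _ hg
    funext x
    refine Subtype.ext ?_
    ext M
    by_cases hM : MonTri.compactObjects K M
    · have h := Set.ext_iff.1 ((hg M hM).trans (hfV M hM).symm) x
      rw [Set.mem_preimage, Set.mem_preimage, MonTri.mem_V_singleton,
        MonTri.mem_V_singleton] at h
      exact not_iff_not.1 h
    · exact ⟨fun h => absurd ((g x).2.thick.le M h) hM, fun h => absurd h.1 hM⟩
  have hΦinj : Function.Injective Φ := Function.LeftInverse.injective (hΘΦ hf)
  -- the support of a prime ideal is a meet-prime specialization-closed set
  have hprime : ∀ P : MonTri.Spc (MonTri.compactObjects K), ∃ x : X,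
      MonTri.Phi σ P.1 = MonTri.specializationInterior ({x}ᶜ : Set X) := by
    intro P
    refine hX.exists_eq_specializationInterior
      (MonTri.isSpecializationClosed_Phi hclosed P.2.thick) (fun h => ?_) (fun Z Z' hZ hZ' h => ?_)
    · refine P.2.proper (le_antisymm P.2.thick.le ?_)
      rw [← MonTri.Theta_Phi_of_faithful hK hσ hf P.2.thick, h]
      exact fun M hM => ⟨hM, Set.subset_univ _⟩
    -- closed sets are supports of thick ideals, so primality of `P` applies to them
    · have hspc : ∀ Y : Set X, IsClosed Y → MonTri.Phi σ (MonTri.Theta σ Y) = Y := fun Y hY =>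
        MonTri.Phi_Theta_of_realizing hK hσ hr ⟨{Y}, by simpa using hY, Set.sUnion_singleton Y⟩
      have hT := fun Y => MonTri.isThickIdeal_Theta hK hσ Y
      have hle : MonTri.tensorCollection (MonTri.Theta σ Z) (MonTri.Theta σ Z') ≤ P.1 := by
        intro M hM
        have hM' := MonTri.isThickIdeal_idealGen
          ⟨_, hT Z, (hT Z).tensorCollection_le (hT Z')⟩
        rw [← MonTri.Theta_Phi_of_faithful hK hσ hf P.2.thick]
        refine MonTri.Theta_mono ?_ _ (hM'.le_Theta_Phi M fun I _ hI => hI M hM)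
        rwa [MonTri.Phi_mul hK hσ (hT Z) (hT Z'), hspc Z hZ, hspc Z' hZ']
      refine (P.2.prime _ _ (hT Z) (hT Z') hle).imp (fun h => ?_) (fun h => ?_)
      · exact (hspc Z hZ).symm.subset.trans (MonTri.Phi_mono h)
      · exact (hspc Z' hZ').symm.subset.trans (MonTri.Phi_mono h)
  have hsurj : Function.Surjective f := by
    intro P
    obtain ⟨x, hx⟩ := hprime P
    refine ⟨x, Subtype.ext ?_⟩
    rw [← MonTri.Theta_Phi_of_faithful hK hσ hf P.2.thick, hx]
    ext M
    refine and_congr_right fun hM => ?_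
    rw [← Set.subset_compl_singleton_iff]
    exact ⟨fun h => Set.subset_sUnion_of_mem ⟨hclosed M hM, h⟩,
      fun h => h.trans (MonTri.specializationInterior_subset _)⟩
  have hle : ∀ {I J}, Φ I ≤ Φ J → I ≤ J := fun {I J} h => by
    rw [← hΘΦ hf I, ← hΘΦ hf J]
    exact hΘmono h
  let e : MonTri.ThickId (MonTri.compactObjects K) ≃*o MonTri.SpClosed X :=
    { toFun := Φ
      invFun := Θ
      left_inv := hΘΦ hf
      right_inv := hΦΘ hr
      map_mul' := hΦmul
      map_le_map_iff' := ⟨hle, hΦmono⟩ }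
  refine ⟨⟨e, fun _ => rfl, fun _ => rfl⟩, ?_, ?_, ?_, hprime, ?_⟩
  · intro I J L
    apply hΦinj
    rw [hΦmul, hΦmul, hΦmul, hΦmul]
    exact Subtype.ext (Set.inter_assoc _ _ _)
  · intro I J L h
    constructor <;> apply hle <;> rw [hΦmul, hΦmul]
    · exact Set.inter_subset_inter_left _ (hΦmono h)
    · exact Set.inter_subset_inter_right _ (hΦmono h)
  · have hE : MonTri.Phi σ (MonTri.compactObjects K) = Set.univ := by
      rw [← Set.univ_subset_iff, ← hσ.unit]
      exact MonTri.subset_Phi hK.compact_unit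
    let E : MonTri.ThickId (MonTri.compactObjects K) := ⟨_, hA⟩
    refine ⟨E, rfl, fun I => ⟨hΦinj ((hΦmul E I).trans (Subtype.ext ?_)),
      hΦinj ((hΦmul I E).trans (Subtype.ext ?_))⟩, hE⟩
    · exact (congrArg (· ∩ MonTri.Phi σ I.1) hE).trans (Set.univ_inter _)
    · exact (congrArg (MonTri.Phi σ I.1 ∩ ·) hE).trans (Set.inter_univ _)
  · refine isHomeomorph_iff_continuous_isClosedMap_bijective.2
      ⟨hcont, fun Z hZ => ?_, hinj hr, hsurj⟩
    obtain ⟨M, hM, rfl⟩ := hr Z hZ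
    -- the image of `Φ(⟨M⟩)` is `V(M)`
    rw [← hfV M hM, Set.image_preimage_eq _ hsurj]
    exact MonTri.isClosed_V (by rintro _ rfl; exact hM)
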